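/- **Setting.** Let $\mathbb K=\mathbb R$ or $\mathbb C$ and let $(\mathbb X_i)_{i\ge 1}$ be self-adjoint $d\times d$ random matrices with entries in $\mathbb K$, defined on a probability space $(\Omega,\mathcal A,\mathbb P)$. Assume that for some constant $M>0$ and all $i\ge1$, the entries of $\mathbb X_i$ are integrable, $\mathbb E(\mathbb X_i)=\mathbf 0$ and $\lambda_{\max}(\mathbb X_i)\le M$ almost surely. For sub-$\sigma$-algebras $\mathcal F,\mathcal G$ of $\mathcal A$ let $$\beta(\mathcal F,\mathcal G)=\tfrac12\sup\sum_{i\in I}\sum_{j\in J}|\mathbb P(A_i\cap B_j)-\mathbb P(A_i)\mathbb P(B_j)|,$$ the supremum being over all finite partitions $(A_i)_{i\in I}$ and $(B_j)_{j\in J}$ of $\Omega$ with elements in $\mathcal F$ and in $\mathcal G$ respectively. Put $\beta_0=1$ and, for $k\ge1$, $\beta_k=\sup_{j\ge1}\beta\big(\sigma(\mathbb X_i,\,1\le i\le j),\,\sigma(\mathbb X_i,\,i\ge j+k)\big)$. **Cantor construction.** Let $A\ge2$ be an integer, $\delta=\frac{\log2}{2\log A}$, and let $\ell$ be the largest integer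 $k\ge1$ with $A\delta(1-\delta)^{k-1}/2^k\ge2$ (put $\ell=0$ if there is none). Let $n_0=A$, $n_j=\lceil A(1-\delta)^j/2^j\rceil$ for $j\ge1$ and $d_j=n_j-2n_{j+1}$; one has $d_j>0$ for $0\le j<\ell$. Let $I_{0,1}=\{1,\dots,A\}$ and, for $0\le j<\ell$ and $1\le i\le2^j$, cut the interval $I_{j,i}$ of $n_j$ consecutive integers into consecutive pieces $I_{j+1,2i-1}$, $I^*_{j,i}$, $I_{j+1,2i}$ (in this order) of cardinalities $n_{j+1}$, $d_j$, $n_{j+1}$. For $0\le m\le\ell$ and $1\le j\le2^m$ let $K_{m,j}=\bigcup_{i=(j-1)2^{\ell-m}+1}^{j2^{\ell-m}}I_{\ell,i}$. **Independent blocks.** For $0\le m\le\ell$ let $(\mathbf V^{(m)}_j)_{1\le j\le2^m}$ be mutually independent families $\mathbf V^{(m)}_j=(\mathbb X^{(m)}_j(i))_{i\in K_{m,j}}$ of random matrices (defined on some probability space, which may differ from $\Omega$ and may depend on $m$) such that $\mathbf V^{(m)}_j$ has the same distribution as $(\mathbb X_i)_{i\in K_{m,j}}$, and put $\mathbb S^{(m)}_j=\sum_{i\in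 K_{m,j}}\mathbb X^{(m)}_j(i)$. **Lemma (decoupling).** For every $t>0$ and every $k\in\{0,\dots,\ell-1\}$, the two expectations below are finite and $$\mathbb E\,\mathrm{Tr}\Big(e^{t\sum_{j=1}^{2^k}\mathbb S^{(k)}_j}\Big)\le\mathbb E\,\mathrm{Tr}\Big(e^{t\sum_{j=1}^{2^{k+1}}\mathbb S^{(k+1)}_j}\Big)\Big(1+\beta_{d_k+1}\,e^{tMn_\ell2^{\ell-k}}\Big)^{2^k}.$$ -/

import Mathlib

open MeasureTheory ProbabilityTheory

noncomputable section

/-! ### Absolute regularity (β-mixing) coefficients -/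

/-- A finite measurable partition of `Ω` with cells in the σ-algebra `m` (empty cells are allowed,
they do not change the coefficients below). -/
structure IsFinPartition {Ω : Type*} (m : MeasurableSpace Ω) {n : ℕ} (P : Fin n → Set Ω) :
    Prop where
  measurable : ∀ i, MeasurableSet[m] (P i)
  disjoint : Pairwise fun i j => Disjoint (P i) (P j)
  cover : ⋃ i, P i = Set.univ

/-- The coefficient `β(𝒜, ℬ)` between two σ-algebras: one half of the supremum of
`∑ᵢ ∑ⱼ |ℙ(Aᵢ ∩ Bⱼ) - ℙ(Aᵢ) ℙ(Bⱼ)|` over all finite partitions `(Aᵢ)`, `(Bⱼ)` of `Ω` with elements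
in `𝒜` and `ℬ`. For a probability measure these sums are at most `2`, so the supremum is that of a
nonempty bounded set of reals. -/
def betaCoeff {Ω : Type*} [MeasurableSpace Ω] (μ : Measure Ω) (𝒜 ℬ : MeasurableSpace Ω) : ℝ :=
  (1 / 2) * sSup {s : ℝ | ∃ (p q : ℕ) (P : Fin p → Set Ω) (Q : Fin q → Set Ω),
    IsFinPartition 𝒜 P ∧ IsFinPartition ℬ Q ∧
      s = ∑ i, ∑ j, |μ.real (P i ∩ Q j) - μ.real (P i) * μ.real (Q j)|}

/-- The σ-algebra generated by the variables `X i`, `i ∈ T`. -/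
@[reducible] def sigmaGen {Ω E : Type*} [MeasurableSpace E] (X : ℕ → Ω → E) (T : Set ℕ) : MeasurableSpace Ω :=
  ⨆ i ∈ T, MeasurableSpace.comap (X i) inferInstance

/-- The coefficients of absolute regularity of the sequence `(X i)`, `i ≥ 1` (the value `X 0` is
not used): `β₀ = 1` and, for `k ≥ 1`,
`βₖ = sup_{j ≥ 1} β(σ(X i, 1 ≤ i ≤ j), σ(X i, i ≥ j + k))`. -/
def betaMix {Ω E : Type*} [MeasurableSpace Ω] [MeasurableSpace E] (μ : Measure Ω)
    (X : ℕ → Ω → E) (k : ℕ) : ℝ :=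
  if k = 0 then 1
  else ⨆ j : {j : ℕ // 1 ≤ j},
    betaCoeff μ (sigmaGen X (Set.Icc 1 (j : ℕ))) (sigmaGen X (Set.Ici ((j : ℕ) + k)))

/-! ### The Cantor-like construction in `{1, …, A}` -/

/-- `δ = log 2 / (2 log A)`. -/
def cantorDelta (A : ℕ) : ℝ := Real.log 2 / (2 * Real.log A)

/-- The depth `ℓ = sup {k ≥ 1 : A δ (1 - δ)^(k-1) / 2^k ≥ 2}`. For `A ≥ 2` this is a bounded set;
if it is empty then `ℓ = 0` and there is no level `k < ℓ`. -/
def cantorDepth (A : ℕ) : ℕ :=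
  sSup {k : ℕ | 1 ≤ k ∧
    2 ≤ (A : ℝ) * cantorDelta A * (1 - cantorDelta A) ^ (k - 1) / 2 ^ k}

/-- The lengths: `n₀ = A` and `nⱼ = ⌈A (1 - δ)^j / 2^j⌉` for `j ≥ 1`. -/
def cantorLen (A : ℕ) (j : ℕ) : ℕ :=
  if j = 0 then A else ⌈(A : ℝ) * (1 - cantorDelta A) ^ j / 2 ^ j⌉₊

/-- The gaps: `dⱼ = nⱼ - 2 nⱼ₊₁`. For `A ≥ 2` and `j < ℓ` the difference is positive, so that the
subtraction is not truncated. -/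
def cantorGap (A : ℕ) (j : ℕ) : ℕ := cantorLen A j - 2 * cantorLen A (j + 1)

/-- The left end `min I_{j,i}` of the `i`-th interval of step `j`, `1 ≤ i ≤ 2^j`. The interval
`I_{j,i}` is cut into `I_{j+1,2i-1}` (at its left end), a gap of `dⱼ` integers, and
`I_{j+1,2i}`. -/
def cantorLeft (A : ℕ) : ℕ → ℕ → ℕ
  | 0, _ => 1
  | j + 1, i => cantorLeft A j ((i + 1) / 2) +
      if Even i then cantorLen A (j + 1) + cantorGap A j else 0

/-- The interval `I_{j,i}` of `nⱼ` consecutive integers, `1 ≤ i ≤ 2^j`. -/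
def cantorInterval (A j i : ℕ) : Finset ℕ :=
  Finset.Ico (cantorLeft A j i) (cantorLeft A j i + cantorLen A j)

/-- The blocks `K_{k,j} = ⋃ I_{ℓ,i}`, the union over `(j-1) 2^(ℓ-k) + 1 ≤ i ≤ j 2^(ℓ-k)`, for
`0 ≤ k ≤ ℓ` and `1 ≤ j ≤ 2^k`. -/
def cantorBlock (A k j : ℕ) : Finset ℕ :=
  (Finset.Icc ((j - 1) * 2 ^ (cantorDepth A - k) + 1) (j * 2 ^ (cantorDepth A - k))).biUnion
    (cantorInterval A (cantorDepth A))

/-! ### Random matrices -/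

/-- Matrices carry the product σ-algebra of their entries: a random matrix is the random vector
of its entries. -/
instance matrixMeasurableSpace {m n α : Type*} [MeasurableSpace α] :
    MeasurableSpace (Matrix m n α) :=
  inferInstanceAs (MeasurableSpace (m → n → α))

/-- The largest eigenvalue of a Hermitian matrix. -/
def lambdaMax {𝕜 : Type*} [RCLike 𝕜] {d : ℕ} (B : Matrix (Fin d) (Fin d) 𝕜) : ℝ :=
  sSup (spectrum ℝ B)

/-- `(V_j)`, `1 ≤ j ≤ 2^m`, is a family of mutually independent random vectors with
`V_j =ᵈ (X i, i ∈ K_{m,j})`; the family may live on a probability space of its own. -/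
structure IsIndepBlocks {Ω Ω' E : Type*} [MeasurableSpace Ω] [MeasurableSpace Ω']
    [MeasurableSpace E] (μ : Measure Ω) (X : ℕ → Ω → E) (A m : ℕ) (μ' : Measure Ω')
    (V : (j : Finset.Icc (1 : ℕ) (2 ^ m)) → Ω' → (cantorBlock A m j → E)) : Prop where
  measurable : ∀ j, Measurable (V j)
  indep : iIndepFun V μ'
  identDistrib : ∀ j, IdentDistrib (V j) (fun ω (i : cantorBlock A m j) => X i ω) μ' μ

/-- The block sum `S_j = ∑_{i ∈ K_{m,j}} V_j(i)`. -/
def blockSum {Ω' E : Type*} [AddCommMonoid E] {A m : ℕ}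
    (V : (j : Finset.Icc (1 : ℕ) (2 ^ m)) → Ω' → (cantorBlock A m j → E))
    (j : Finset.Icc (1 : ℕ) (2 ^ m)) (ω : Ω') : E :=
  ∑ i, V j ω i

/-- `Tr e^B`, as a real number (for Hermitian `B` the trace of `e^B` is real). -/
def trExp {𝕜 : Type*} [RCLike 𝕜] {d : ℕ} (B : Matrix (Fin d) (Fin d) 𝕜) : ℝ :=
  RCLike.re (NormedSpace.exp B).trace

end

/-! The blocks of level `k` are replaced one at a time by two independent halves. Fix one block, let
`π` be the law of `t` times its sum, `ρ` the law of `t` times the sum of independent copies of its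
two halves, and `κ` the law of all remaining independent summands. The function `f(x) = ∫ Tr e^(x+a)
dκ(a)` then carries the whole comparison.

Mixing: the halves are separated by the gap, so their joint law exceeds the product law by at most
`β = β_{d_k+1}` on every measurable set. Pushing forward by addition, `π(D) ≤ ρ(D) + β` for every
measurable `D` (`map_prod_le_add_betaCoeff`). No coupling is constructed: by the layer-cake formula,
`∫ f dπ ≤ ∫ f dρ + β sup f`.

Boundedness: both laws live on Hermitian `x ≤ C` with `C = t M n_ℓ 2^(ℓ-k)`, and there `0 ≤ f(x) ≤
e^C ∫ Tr e^a dκ(a)` (`trExp_add_le`). Only an upper bound on the spectrum is used.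

Centring: `∫ Tr e^a dκ(a) ≤ ∫ f dρ`, a Jensen inequality for the trace exponential
(`trExp_le_integral_trExp_add`). The error is therefore multiplicative and each replacement costs a
factor `1 + β e^C` (`integral_trExp_conv_le`). The `2^k` replacements give the power
(`integral_trExp_conv_map_sum_le`).

All the matrix analysis reduces to Peierls' inequality `∑ e^(B_jj) ≤ Tr e^B`, read in a well-chosen
orthonormal basis. -/

/-! ### Trace inequalities for exponentials of Hermitian matrices -/

section TraceExponential

open scoped ComplexOrder

variable {𝕜 : Type*} [RCLike 𝕜] {d : ℕ}

open Matrix in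
theorem trExp_unitary_conj {U : Matrix (Fin d) (Fin d) 𝕜}
    (hU : U ∈ Matrix.unitaryGroup (Fin d) 𝕜) (B : Matrix (Fin d) (Fin d) 𝕜) :
    trExp (star U * B * U) = trExp B := by
  have h1 : star U * U = 1 := (Matrix.mem_unitaryGroup_iff').1 hU
  have h2 : U⁻¹ = star U := Matrix.inv_eq_left_inv h1
  have hu : IsUnit U := IsUnit.of_mul_eq_one_right _ h1
  unfold trExp
  rw [← h2, Matrix.exp_conj' U B hu, Matrix.trace_mul_cycle, h2,
    (Matrix.mem_unitaryGroup_iff).1 hU, one_mul]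

theorem trExp_diagonal (l : Fin d → ℝ) :
    trExp (Matrix.diagonal fun i => (l i : 𝕜)) = ∑ i, Real.exp (l i) := by
  unfold trExp
  rw [Matrix.exp_diagonal, Matrix.trace_diagonal, map_sum]
  refine Finset.sum_congr rfl fun i _ => ?_
  rw [Pi.coe_exp]
  have : NormedSpace.exp (l i : 𝕜) = ((Real.exp (l i) : ℝ) : 𝕜) := by
    rw [Real.exp_eq_exp_ℝ]
    exact (NormedSpace.algebraMap_exp_comm (𝕂 := ℝ) (𝔸 := 𝕜) (l i)).symm
  rw [this, RCLike.ofReal_re]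

theorem Matrix.IsHermitian.exists_unitary_diagonal {B : Matrix (Fin d) (Fin d) 𝕜}
    (hB : B.IsHermitian) :
    ∃ U ∈ Matrix.unitaryGroup (Fin d) 𝕜,
      star U * B * U = Matrix.diagonal fun i => (hB.eigenvalues i : 𝕜) := by
  refine ⟨hB.eigenvectorUnitary, hB.eigenvectorUnitary.2, ?_⟩
  have := hB.conjStarAlgAut_star_eigenvectorUnitary
  rw [Unitary.conjStarAlgAut_star_apply] at this
  exact this

/-- Peierls' inequality for the standard basis. -/
theorem sum_exp_diag_le_trExp {B : Matrix (Fin d) (Fin d) 𝕜} (hB : B.IsHermitian) :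
    ∑ j, Real.exp (RCLike.re (B j j)) ≤ trExp B := by
  obtain ⟨U, hU, hD⟩ := hB.exists_unitary_diagonal
  set l := hB.eigenvalues
  have h1 : star U * U = 1 := (Matrix.mem_unitaryGroup_iff').1 hU
  have h2 : U * star U = 1 := (Matrix.mem_unitaryGroup_iff).1 hU
  have hrow : ∀ j, ∑ i, ‖U j i‖ ^ 2 = 1 := by
    intro j
    have := congrFun (congrFun h2 j) j
    simp only [Matrix.mul_apply, Matrix.star_apply, Matrix.one_apply_eq, RCLike.star_def,
      RCLike.mul_conj] at this
    exact_mod_cast this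
  have hcol : ∀ i, ∑ j, ‖U j i‖ ^ 2 = 1 := by
    intro i
    have := congrFun (congrFun h1 i) i
    simp only [Matrix.mul_apply, Matrix.star_apply, Matrix.one_apply_eq, RCLike.star_def,
      RCLike.conj_mul] at this
    exact_mod_cast this
  have hBU : B = U * (Matrix.diagonal fun i => (l i : 𝕜)) * star U := by
    rw [← hD]
    calc B = (U * star U) * B * (U * star U) := by rw [h2, one_mul, mul_one]
      _ = _ := by simp only [mul_assoc]
  -- The weights `‖U j i‖ ^ 2` are doubly stochastic: row sums allow Jensen for each diagonal entry,
  -- column sums collapse the double sum.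
  have hdiag : ∀ j, RCLike.re (B j j) = ∑ i, ‖U j i‖ ^ 2 * l i := by
    intro j
    have : B j j = ((∑ i, ‖U j i‖ ^ 2 * l i : ℝ) : 𝕜) := by
      conv_lhs => rw [hBU]
      rw [Matrix.mul_apply]
      push_cast
      refine Finset.sum_congr rfl fun i _ => ?_
      rw [Matrix.mul_diagonal, Matrix.star_apply, mul_right_comm, RCLike.star_def,
        RCLike.mul_conj]
    rw [this, RCLike.ofReal_re]
  have htr : trExp B = ∑ i, Real.exp (l i) := by
    rw [← trExp_unitary_conj hU, hD, trExp_diagonal]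
  rw [htr]
  calc ∑ j, Real.exp (RCLike.re (B j j))
      ≤ ∑ j, ∑ i, ‖U j i‖ ^ 2 * Real.exp (l i) := by
        refine Finset.sum_le_sum fun j _ => ?_
        rw [hdiag j]
        have := convexOn_exp.map_sum_le (t := Finset.univ) (w := fun i => ‖U j i‖ ^ 2) (p := l)
          (fun i _ => by positivity) (hrow j) (fun _ _ => Set.mem_univ _)
        simpa [smul_eq_mul] using this
    _ = ∑ i, Real.exp (l i) := by
        rw [Finset.sum_comm]
        refine Finset.sum_congr rfl fun i _ => ?_
        rw [← Finset.sum_mul, hcol i, one_mul]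

theorem trExp_nonneg {B : Matrix (Fin d) (Fin d) 𝕜} (hB : B.IsHermitian) : 0 ≤ trExp B :=
  (Finset.sum_nonneg fun _ _ => (Real.exp_pos _).le).trans (sum_exp_diag_le_trExp hB)

theorem isHermitian_star_mul_mul {B : Matrix (Fin d) (Fin d) 𝕜} (hB : B.IsHermitian)
    (U : Matrix (Fin d) (Fin d) 𝕜) : (star U * B * U).IsHermitian := by
  rw [Matrix.star_eq_conjTranspose]
  exact Matrix.isHermitian_conjTranspose_mul_mul U hB

/-- The set of Hermitian matrices `B` with `B ≤ C` in the Loewner order. -/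
def loewnerLe (𝕜 : Type*) [RCLike 𝕜] (d : ℕ) (C : ℝ) : Set (Matrix (Fin d) (Fin d) 𝕜) :=
  {B | (C • (1 : Matrix (Fin d) (Fin d) 𝕜) - B).PosSemidef}

theorem isHermitian_of_mem_loewnerLe {C : ℝ} {B : Matrix (Fin d) (Fin d) 𝕜}
    (hB : B ∈ loewnerLe 𝕜 d C) : B.IsHermitian := by
  have h : (C • (1 : Matrix (Fin d) (Fin d) 𝕜)).IsHermitian :=
    Matrix.isHermitian_one.smul (by simp [IsSelfAdjoint])
  have := h.sub (Matrix.PosSemidef.isHermitian hB)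
  simpa using this

theorem add_mem_loewnerLe {C C' : ℝ} {B B' : Matrix (Fin d) (Fin d) 𝕜}
    (hB : B ∈ loewnerLe 𝕜 d C) (hB' : B' ∈ loewnerLe 𝕜 d C') :
    B + B' ∈ loewnerLe 𝕜 d (C + C') := by
  have := Matrix.PosSemidef.add hB hB'
  simp only [loewnerLe, Set.mem_ofPred_eq]
  convert this using 1
  rw [add_smul]
  abel

theorem zero_mem_loewnerLe : (0 : Matrix (Fin d) (Fin d) 𝕜) ∈ loewnerLe 𝕜 d 0 := by
  simpa [loewnerLe] using Matrix.PosSemidef.zero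

theorem loewnerLe_mono {C C' : ℝ} (h : C ≤ C') : loewnerLe 𝕜 d C ⊆ loewnerLe 𝕜 d C' := by
  intro B hB
  have h0 : (0 : Matrix (Fin d) (Fin d) 𝕜) ∈ loewnerLe 𝕜 d (C' - C) := by
    simp only [loewnerLe, Set.mem_ofPred_eq, sub_zero]
    exact Matrix.PosSemidef.one.smul (sub_nonneg.2 h)
  simpa using add_mem_loewnerLe hB h0

theorem sum_mem_loewnerLe {ι : Type*} (s : Finset ι) {C : ℝ}
    {B : ι → Matrix (Fin d) (Fin d) 𝕜} (hB : ∀ i ∈ s, B i ∈ loewnerLe 𝕜 d C) :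
    ∑ i ∈ s, B i ∈ loewnerLe 𝕜 d (s.card * C) := by
  classical
  induction s using Finset.induction_on with
  | empty => simpa using zero_mem_loewnerLe
  | insert a s ha ih =>
    rw [Finset.sum_insert ha, Finset.card_insert_of_notMem ha]
    have := add_mem_loewnerLe (hB a (Finset.mem_insert_self a s))
      (ih fun i hi => hB i (Finset.mem_insert_of_mem hi))
    convert this using 2
    push_cast
    ring

theorem smul_mem_loewnerLe {t C : ℝ} (ht : 0 ≤ t) {B : Matrix (Fin d) (Fin d) 𝕜}
    (hB : B ∈ loewnerLe 𝕜 d C) : t • B ∈ loewnerLe 𝕜 d (t * C) := by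
  have := Matrix.PosSemidef.smul hB ht
  simp only [loewnerLe, Set.mem_ofPred_eq]
  convert this using 1
  rw [smul_sub, smul_smul]

/-- Turns the eigenvalue hypothesis into an order relation that is stable under sums. After
diagonalisation it is a condition on each eigenvalue. -/
theorem mem_loewnerLe_of_lambdaMax_le {C : ℝ} {B : Matrix (Fin d) (Fin d) 𝕜}
    (hB : B.IsHermitian) (h : lambdaMax B ≤ C) : B ∈ loewnerLe 𝕜 d C := by
  have hl : ∀ i, hB.eigenvalues i ≤ C := fun i =>
    (le_csSup Matrix.finite_real_spectrum.bddAbove (hB.eigenvalues_mem_spectrum_real i)).trans h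
  obtain ⟨U, hU, hD⟩ := hB.exists_unitary_diagonal
  have h1 : star U * U = 1 := (Matrix.mem_unitaryGroup_iff').1 hU
  have hu : IsUnit U := IsUnit.of_mul_eq_one_right _ h1
  simp only [loewnerLe, Set.mem_ofPred_eq]
  rw [← Matrix.IsUnit.posSemidef_star_left_conjugate_iff hu, mul_sub, sub_mul, hD, mul_smul_comm,
    smul_mul_assoc, mul_one, h1, ← Matrix.diagonal_one, ← Matrix.diagonal_smul,
    Matrix.diagonal_sub, Matrix.posSemidef_diagonal_iff]
  intro i
  have : (C • (1 : Fin d → 𝕜)) i - (hB.eigenvalues i : 𝕜) = ((C - hB.eigenvalues i : ℝ) : 𝕜) := by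
    simp [RCLike.real_smul_eq_coe_mul]
  simp only [Pi.smul_apply, Pi.one_apply] at this ⊢
  rw [this]
  exact_mod_cast sub_nonneg.2 (hl i)

theorem isClosed_loewnerLe (C : ℝ) : IsClosed (loewnerLe 𝕜 d C) := by
  have : loewnerLe 𝕜 d C = {B | (C • (1 : Matrix (Fin d) (Fin d) 𝕜) - B).IsHermitian} ∩
      ⋂ x : Fin d → 𝕜, {B | 0 ≤ star x ⬝ᵥ
        (Matrix.mulVec (C • (1 : Matrix (Fin d) (Fin d) 𝕜) - B) x)} := by
    ext B
    simp only [loewnerLe, Set.mem_ofPred_eq, Set.mem_inter_iff, Set.mem_iInter]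
    exact Matrix.posSemidef_iff_dotProduct_mulVec
  rw [this]
  refine IsClosed.inter ?_ (isClosed_iInter fun x => ?_)
  · exact isClosed_eq (by fun_prop) (by fun_prop)
  · exact isClosed_le continuous_const (by fun_prop)

/-- Adding a matrix bounded by `C` multiplies the trace exponential by at most `e^C`. -/
theorem trExp_add_le {C : ℝ} {B B' : Matrix (Fin d) (Fin d) 𝕜} (hB : B.IsHermitian)
    (hB' : B' ∈ loewnerLe 𝕜 d C) : trExp (B + B') ≤ Real.exp C * trExp B := by
  have hs := hB.add (isHermitian_of_mem_loewnerLe hB')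
  obtain ⟨U, hU, hD⟩ := hs.exists_unitary_diagonal
  have h1 : star U * U = 1 := (Matrix.mem_unitaryGroup_iff').1 hU
  -- In an eigenbasis of `B + B'` each eigenvalue is a diagonal entry of `B` plus one of `B'`, and
  -- the latter is at most `C`. Peierls' inequality for `B` in this basis then concludes.
  have hdiag : ∀ j, hs.eigenvalues j ≤ C + RCLike.re ((star U * B * U) j j) := by
    intro j
    have e := congrFun (congrFun hD j) j
    rw [Matrix.diagonal_apply_eq] at e
    have hp := (Matrix.PosSemidef.conjTranspose_mul_mul_same hB' U).diag_nonneg (i := j)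
    rw [← Matrix.star_eq_conjTranspose, mul_sub, sub_mul, mul_smul_comm, smul_mul_assoc, mul_one,
      h1, Matrix.sub_apply, Matrix.smul_apply, Matrix.one_apply_eq] at hp
    have hp' := (RCLike.nonneg_iff.1 hp).1
    have e' := congrArg RCLike.re e
    rw [mul_add, add_mul, Matrix.add_apply, map_add, RCLike.ofReal_re] at e'
    rw [map_sub, RCLike.smul_re, RCLike.one_re] at hp'
    linarith
  rw [← trExp_unitary_conj hU (B + B'), hD, trExp_diagonal, ← trExp_unitary_conj hU B]
  calc ∑ j, Real.exp (hs.eigenvalues j)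
      ≤ ∑ j, Real.exp C * Real.exp (RCLike.re ((star U * B * U) j j)) := by
        refine Finset.sum_le_sum fun j _ => ?_
        rw [← Real.exp_add]
        exact Real.exp_le_exp.2 (hdiag j)
    _ ≤ _ := by
        rw [← Finset.mul_sum]
        exact mul_le_mul_of_nonneg_left
          (sum_exp_diag_le_trExp (isHermitian_star_mul_mul hB U)) (Real.exp_pos _).le

theorem trExp_le_of_mem_loewnerLe {C : ℝ} {B : Matrix (Fin d) (Fin d) 𝕜}
    (hB : B ∈ loewnerLe 𝕜 d C) : trExp B ≤ Real.exp C * d := by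
  have h := trExp_add_le (B := 0) Matrix.isHermitian_zero hB
  rw [zero_add] at h
  have h0 : trExp (0 : Matrix (Fin d) (Fin d) 𝕜) = d := by
    have := trExp_diagonal (𝕜 := 𝕜) (d := d) (fun _ => 0)
    simpa using this
  rwa [h0] at h

theorem continuous_trExp : Continuous (trExp : Matrix (Fin d) (Fin d) 𝕜 → ℝ) := by
  have h : Continuous (NormedSpace.exp : Matrix (Fin d) (Fin d) 𝕜 → _) := by
    -- Continuity of the exponential is obtained in a normed algebra; the operator norm serves
    -- because it induces the entrywise topology.
    open scoped Matrix.Norms.Operator in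
    let _ : NormedAlgebra ℚ (Matrix (Fin d) (Fin d) 𝕜) := NormedAlgebra.restrictScalars ℚ 𝕜 _
    exact NormedSpace.exp_continuous
  exact RCLike.continuous_re.comp h.matrix_trace

instance matrixBorelSpace : BorelSpace (Matrix (Fin d) (Fin d) 𝕜) :=
  inferInstanceAs (BorelSpace (Fin d → Fin d → 𝕜))

instance matrixSecondCountable : SecondCountableTopology (Matrix (Fin d) (Fin d) 𝕜) :=
  inferInstanceAs (SecondCountableTopology (Fin d → Fin d → 𝕜))

theorem measurable_trExp : Measurable (trExp : Matrix (Fin d) (Fin d) 𝕜 → ℝ) :=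
  continuous_trExp.measurable

theorem measurableSet_loewnerLe (C : ℝ) : MeasurableSet (loewnerLe 𝕜 d C) :=
  (isClosed_loewnerLe C).measurableSet


end TraceExponential

/-! ### Absolute regularity as a total variation bound -/

section AbsoluteRegularity

variable {Ω : Type*} {𝒜 ℬ mΩ : MeasurableSpace Ω} (μ : Measure Ω)

theorem betaCoeff_nonneg : 0 ≤ betaCoeff μ 𝒜 ℬ := by
  unfold betaCoeff
  refine mul_nonneg (by norm_num) (Real.sSup_nonneg ?_)
  rintro s ⟨p, q, P, Q, hP, hQ, rfl⟩
  positivity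

theorem betaMix_nonneg {E : Type*} [MeasurableSpace E] (X : ℕ → Ω → E) (k : ℕ) :
    0 ≤ betaMix μ X k := by
  unfold betaMix
  split_ifs
  · exact zero_le_one
  · exact Real.iSup_nonneg fun _ => betaCoeff_nonneg μ

variable [IsProbabilityMeasure μ]

theorem IsFinPartition.sum_measureReal (h𝒜 : 𝒜 ≤ mΩ) {n : ℕ}
    {P : Fin n → Set Ω} (hP : IsFinPartition 𝒜 P) : ∑ i, μ.real (P i) = 1 := by
  rw [← measureReal_iUnion_fintype hP.disjoint fun i => h𝒜 _ (hP.measurable i), hP.cover,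
    probReal_univ]

theorem IsFinPartition.sum_measureReal_inter (h𝒜 : 𝒜 ≤ mΩ)
    (hℬ : ℬ ≤ mΩ) {p q : ℕ} {P : Fin p → Set Ω} {Q : Fin q → Set Ω}
    (hP : IsFinPartition 𝒜 P) (hQ : IsFinPartition ℬ Q) :
    ∑ i, ∑ j, μ.real (P i ∩ Q j) = 1 := by
  rw [← hP.sum_measureReal μ h𝒜]
  refine Finset.sum_congr rfl fun i _ => ?_
  rw [← measureReal_iUnion_fintype, ← Set.inter_iUnion, hQ.cover, Set.inter_univ]
  · exact fun a b hab => (hQ.disjoint hab).mono Set.inter_subset_right Set.inter_subset_right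
  · exact fun j => (h𝒜 _ (hP.measurable i)).inter (hℬ _ (hQ.measurable j))

theorem IsFinPartition.sum_mul_measureReal (h𝒜 : 𝒜 ≤ mΩ)
    (hℬ : ℬ ≤ mΩ) {p q : ℕ} {P : Fin p → Set Ω} {Q : Fin q → Set Ω}
    (hP : IsFinPartition 𝒜 P) (hQ : IsFinPartition ℬ Q) :
    ∑ i, ∑ j, μ.real (P i) * μ.real (Q j) = 1 := by
  rw [← Finset.sum_mul_sum, hP.sum_measureReal μ h𝒜, hQ.sum_measureReal μ hℬ, one_mul]

theorem sum_abs_le_two (h𝒜 : 𝒜 ≤ mΩ) (hℬ : ℬ ≤ mΩ) {p q : ℕ}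
    {P : Fin p → Set Ω} {Q : Fin q → Set Ω} (hP : IsFinPartition 𝒜 P)
    (hQ : IsFinPartition ℬ Q) :
    ∑ i, ∑ j, |μ.real (P i ∩ Q j) - μ.real (P i) * μ.real (Q j)| ≤ 2 := by
  calc ∑ i, ∑ j, |μ.real (P i ∩ Q j) - μ.real (P i) * μ.real (Q j)|
      ≤ ∑ i, ∑ j, (μ.real (P i ∩ Q j) + μ.real (P i) * μ.real (Q j)) := by
        refine Finset.sum_le_sum fun i _ => Finset.sum_le_sum fun j _ => ?_
        refine (abs_sub _ _).trans ?_
        rw [abs_of_nonneg measureReal_nonneg,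
          abs_of_nonneg (mul_nonneg measureReal_nonneg measureReal_nonneg)]
    _ = 2 := by
        simp only [Finset.sum_add_distrib]
        rw [hP.sum_measureReal_inter μ h𝒜 hℬ hQ, hP.sum_mul_measureReal μ h𝒜 hℬ hQ]
        norm_num

theorem half_sum_abs_le_betaCoeff (h𝒜 : 𝒜 ≤ mΩ) (hℬ : ℬ ≤ mΩ)
    {p q : ℕ} {P : Fin p → Set Ω} {Q : Fin q → Set Ω} (hP : IsFinPartition 𝒜 P)
    (hQ : IsFinPartition ℬ Q) :
    (1 / 2) * ∑ i, ∑ j, |μ.real (P i ∩ Q j) - μ.real (P i) * μ.real (Q j)| ≤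
      betaCoeff μ 𝒜 ℬ := by
  unfold betaCoeff
  refine mul_le_mul_of_nonneg_left (le_csSup ⟨2, ?_⟩ ⟨p, q, P, Q, hP, hQ, rfl⟩) (by norm_num)
  rintro s ⟨p, q, P, Q, hP, hQ, rfl⟩
  exact sum_abs_le_two μ h𝒜 hℬ hP hQ

theorem betaCoeff_le_one (h𝒜 : 𝒜 ≤ mΩ) (hℬ : ℬ ≤ mΩ) :
    betaCoeff μ 𝒜 ℬ ≤ 1 := by
  have : sSup {s : ℝ | ∃ (p q : ℕ) (P : Fin p → Set Ω) (Q : Fin q → Set Ω),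
    IsFinPartition 𝒜 P ∧ IsFinPartition ℬ Q ∧
      s = ∑ i, ∑ j, |μ.real (P i ∩ Q j) - μ.real (P i) * μ.real (Q j)|} ≤ 2 := by
    refine Real.sSup_le ?_ (by norm_num)
    rintro s ⟨p, q, P, Q, hP, hQ, rfl⟩
    exact sum_abs_le_two μ h𝒜 hℬ hP hQ
  unfold betaCoeff
  linarith

theorem sigmaGen_le {E : Type*} [MeasurableSpace E] {X : ℕ → Ω → E} {T : Set ℕ}
    (hX : ∀ i ∈ T, Measurable (X i)) : sigmaGen X T ≤ mΩ :=
  iSup₂_le fun i hi => (hX i hi).comap_le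

theorem measurable_sigmaGen {E : Type*} [MeasurableSpace E] {X : ℕ → Ω → E} {T : Set ℕ}
    {i : ℕ} (hi : i ∈ T) : Measurable[sigmaGen X T] (X i) :=
  measurable_iff_comap_le.2 (le_iSup₂_of_le i hi le_rfl)

theorem betaCoeff_le_betaMix {E : Type*} [MeasurableSpace E] {X : ℕ → Ω → E}
    (hX : ∀ i, 1 ≤ i → Measurable (X i)) {j k : ℕ} (hj : 1 ≤ j) (hk : k ≠ 0) :
    betaCoeff μ (sigmaGen X (Set.Icc 1 j)) (sigmaGen X (Set.Ici (j + k))) ≤ betaMix μ X k := by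
  unfold betaMix
  rw [if_neg hk]
  -- A real supremum dominates its terms only for a bounded family; here the bound is `1`.
  refine le_ciSup (f := fun j : {j : ℕ // 1 ≤ j} =>
    betaCoeff μ (sigmaGen X (Set.Icc 1 (j : ℕ))) (sigmaGen X (Set.Ici ((j : ℕ) + k))))
    ⟨1, ?_⟩ ⟨j, hj⟩
  rintro _ ⟨i, rfl⟩
  exact betaCoeff_le_one μ (sigmaGen_le fun a ha => hX a ha.1)
    (sigmaGen_le fun a ha => hX a (by have := i.2; have : (i : ℕ) + k ≤ a := ha; omega))

/-- The sets that are finite unions of cells of a product partition. -/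
def gridSets (E F : Type*) [MeasurableSpace E] [MeasurableSpace F] : Set (Set (E × F)) :=
  {D | ∃ (p q : ℕ) (f : E → Fin p) (g : F → Fin q) (S : Set (Fin p × Fin q)),
    Measurable f ∧ Measurable g ∧ D = Prod.map f g ⁻¹' S}

variable {E F : Type*} [MeasurableSpace E] [MeasurableSpace F]

/-- Pairing the labels, `(f, f')` and `(g, g')`, gives a common refinement of the two grids. Closure
under union and difference then takes place among the label sets. -/
theorem gridSets_exists_common {D D' : Set (E × F)} (hD : D ∈ gridSets E F)
    (hD' : D' ∈ gridSets E F) :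
    ∃ (p q : ℕ) (f : E → Fin p) (g : F → Fin q) (S S' : Set (Fin p × Fin q)),
      Measurable f ∧ Measurable g ∧ D = Prod.map f g ⁻¹' S ∧ D' = Prod.map f g ⁻¹' S' := by
  obtain ⟨p, q, f, g, S, hf, hg, rfl⟩ := hD
  obtain ⟨p', q', f', g', S', hf', hg', rfl⟩ := hD'
  refine ⟨p * p', q * q', fun x => finProdFinEquiv (f x, f' x),
    fun y => finProdFinEquiv (g y, g' y),
    {z | ((finProdFinEquiv.symm z.1).1, (finProdFinEquiv.symm z.2).1) ∈ S},
    {z | ((finProdFinEquiv.symm z.1).2, (finProdFinEquiv.symm z.2).2) ∈ S'}, ?_, ?_, ?_, ?_⟩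
  · exact (measurable_of_countable _).comp (hf.prodMk hf')
  · exact (measurable_of_countable _).comp (hg.prodMk hg')
  · ext x
    simp only [Set.mem_preimage, Prod.map, Set.mem_ofPred_eq, Equiv.symm_apply_apply]
  · ext x
    simp only [Set.mem_preimage, Prod.map, Set.mem_ofPred_eq, Equiv.symm_apply_apply]

theorem isSetRing_gridSets : IsSetRing (gridSets E F) where
  empty_mem := ⟨1, 1, fun _ => 0, fun _ => 0, ∅, measurable_const, measurable_const, by simp⟩
  union_mem D D' hD hD' := by
    obtain ⟨p, q, f, g, S, S', hf, hg, rfl, rfl⟩ := gridSets_exists_common hD hD'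
    exact ⟨p, q, f, g, S ∪ S', hf, hg, by simp⟩
  sdiff_mem D D' hD hD' := by
    obtain ⟨p, q, f, g, S, S', hf, hg, rfl, rfl⟩ := gridSets_exists_common hD hD'
    exact ⟨p, q, f, g, S \ S', hf, hg, by simp⟩

theorem univ_mem_gridSets : (Set.univ : Set (E × F)) ∈ gridSets E F :=
  ⟨1, 1, fun _ => 0, fun _ => 0, Set.univ, measurable_const, measurable_const, by simp⟩

theorem generateFrom_gridSets :
    (inferInstance : MeasurableSpace (E × F)) = MeasurableSpace.generateFrom (gridSets E F) := by
  classical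
  refine le_antisymm ?_ (MeasurableSpace.generateFrom_le ?_)
  · change Prod.instMeasurableSpace ≤ _
    rw [← generateFrom_prod]
    refine MeasurableSpace.generateFrom_mono ?_
    rintro _ ⟨s, hs, t, ht, rfl⟩
    -- A measurable rectangle is one cell of the grid formed by `{s, sᶜ}` and `{t, tᶜ}`.
    refine ⟨2, 2, fun x => if x ∈ s then 1 else 0, fun y => if y ∈ t then 1 else 0, {(1, 1)},
      Measurable.ite hs measurable_const measurable_const,
      Measurable.ite ht measurable_const measurable_const, ?_⟩
    ext x
    simp [Prod.map, Prod.ext_iff]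
  · rintro _ ⟨p, q, f, g, S, hf, hg, rfl⟩
    exact (hf.prodMap hg) (Set.toFinite S).measurableSet

theorem isFinPartition_preimage {p : ℕ} {f : Ω → Fin p}
    (hf : Measurable[𝒜] f) : IsFinPartition 𝒜 fun i => f ⁻¹' {i} where
  measurable i := hf (measurableSet_singleton i)
  disjoint i j hij := by
    refine Set.disjoint_left.2 fun x hx hx' => hij ?_
    simp only [Set.mem_preimage, Set.mem_singleton_iff] at hx hx'
    rw [← hx, hx']
  cover := by
    ext x
    simp

/-- On a grid set both measures are finite sums over cells, and the cells pull back to partitions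
admissible in the definition of `betaCoeff`. -/
theorem map_prod_sub_le_betaCoeff_of_gridSets (h𝒜 : 𝒜 ≤ mΩ)
    (hℬ : ℬ ≤ mΩ) {Y : Ω → E} {Z : Ω → F} (hY : Measurable[𝒜] Y) (hZ : Measurable[ℬ] Z)
    {D : Set (E × F)} (hD : D ∈ gridSets E F) :
    (μ.map fun ω => (Y ω, Z ω)).real D ≤
      ((μ.map Y).prod (μ.map Z)).real D + betaCoeff μ 𝒜 ℬ := by
  classical
  obtain ⟨p, q, f, g, S, hf, hg, rfl⟩ := hD
  have hY' : Measurable Y := hY.mono h𝒜 le_rfl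
  have hZ' : Measurable Z := hZ.mono hℬ le_rfl
  have hP : IsFinPartition 𝒜 fun i => (f ∘ Y) ⁻¹' {i} :=
    isFinPartition_preimage (hf.comp hY)
  have hQ : IsFinPartition ℬ fun i => (g ∘ Z) ⁻¹' {i} :=
    isFinPartition_preimage (hg.comp hZ)
  have hb := half_sum_abs_le_betaCoeff μ h𝒜 hℬ hP hQ
  have hs1 := hP.sum_measureReal_inter μ h𝒜 hℬ hQ
  have hs2 := hP.sum_mul_measureReal μ h𝒜 hℬ hQ
  set x : Fin p × Fin q → ℝ := fun z => μ.real ((f ∘ Y) ⁻¹' {z.1} ∩ (g ∘ Z) ⁻¹' {z.2})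
  set y : Fin p × Fin q → ℝ := fun z => μ.real ((f ∘ Y) ⁻¹' {z.1}) * μ.real ((g ∘ Z) ⁻¹' {z.2})
  have : IsProbabilityMeasure (μ.map Y) := Measure.isProbabilityMeasure_map hY'.aemeasurable
  have : IsProbabilityMeasure (μ.map Z) := Measure.isProbabilityMeasure_map hZ'.aemeasurable
  have : IsProbabilityMeasure (μ.map fun ω => (Y ω, Z ω)) :=
    Measure.isProbabilityMeasure_map (hY'.prodMk hZ').aemeasurable
  have e1 : (μ.map fun ω => (Y ω, Z ω)).real (Prod.map f g ⁻¹' S) = ∑ z ∈ S.toFinset, x z := by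
    rw [← Set.coe_toFinset S, ← sum_measureReal_preimage_singleton]
    · simp only [Finset.toFinset_coe]
      refine Finset.sum_congr rfl fun z _ => ?_
      rw [map_measureReal_apply (hY'.prodMk hZ')
        ((hf.prodMap hg) (measurableSet_singleton z))]
      congr 1
      ext ω
      simp [Prod.ext_iff]
    · exact fun z _ => (hf.prodMap hg) (measurableSet_singleton z)
  have e2 : ((μ.map Y).prod (μ.map Z)).real (Prod.map f g ⁻¹' S) = ∑ z ∈ S.toFinset, y z := by
    rw [← Set.coe_toFinset S, ← sum_measureReal_preimage_singleton]
    · simp only [Finset.toFinset_coe]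
      refine Finset.sum_congr rfl fun z _ => ?_
      have : Prod.map f g ⁻¹' {z} = (f ⁻¹' {z.1}) ×ˢ (g ⁻¹' {z.2}) := by
        ext w
        simp [Prod.ext_iff]
      rw [this, measureReal_prod_prod, map_measureReal_apply hY' (hf (measurableSet_singleton _)),
        map_measureReal_apply hZ' (hg (measurableSet_singleton _))]
      rfl
    · exact fun z _ => (hf.prodMap hg) (measurableSet_singleton z)
  have t1 : ∑ z, x z = 1 := by rw [Fintype.sum_prod_type]; exact hs1
  have t2 : ∑ z, y z = 1 := by rw [Fintype.sum_prod_type]; exact hs2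
  have hb' : (1 / 2) * ∑ z, |x z - y z| ≤ betaCoeff μ 𝒜 ℬ := by
    rw [Fintype.sum_prod_type]; exact hb
  -- Since `x` and `y` both have total mass `1`, the positive part of `x - y` carries exactly half
  -- of its `ℓ¹` norm. This matches the factor `1 / 2` in `betaCoeff`.
  have hmain : ∑ z ∈ S.toFinset, (x z - y z) ≤ (1 / 2) * ∑ z, |x z - y z| := by
    calc ∑ z ∈ S.toFinset, (x z - y z)
        ≤ ∑ z ∈ S.toFinset, (1 / 2) * (|x z - y z| + (x z - y z)) :=
          Finset.sum_le_sum fun z _ => by linarith [le_abs_self (x z - y z)]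
      _ ≤ ∑ z, (1 / 2) * (|x z - y z| + (x z - y z)) :=
          Finset.sum_le_sum_of_subset_of_nonneg (Finset.subset_univ _)
            fun z _ _ => by linarith [neg_abs_le (x z - y z)]
      _ = (1 / 2) * ∑ z, |x z - y z| := by
          rw [← Finset.mul_sum, Finset.sum_add_distrib, Finset.sum_sub_distrib, t1, t2]
          ring
  rw [e1, e2]
  rw [Finset.sum_sub_distrib] at hmain
  linarith

/-- The joint law of two variables and the product of their laws differ in total variation by at
most the coefficient of absolute regularity. -/
theorem map_prod_le_add_betaCoeff (h𝒜 : 𝒜 ≤ mΩ)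
    (hℬ : ℬ ≤ mΩ) {Y : Ω → E} {Z : Ω → F} (hY : Measurable[𝒜] Y) (hZ : Measurable[ℬ] Z)
    {D : Set (E × F)} (hD : MeasurableSet D) :
    (μ.map fun ω => (Y ω, Z ω)).real D ≤
      ((μ.map Y).prod (μ.map Z)).real D + betaCoeff μ 𝒜 ℬ := by
  have hY' : Measurable Y := hY.mono h𝒜 le_rfl
  have hZ' : Measurable Z := hZ.mono hℬ le_rfl
  have : IsProbabilityMeasure (μ.map Y) := Measure.isProbabilityMeasure_map hY'.aemeasurable
  have : IsProbabilityMeasure (μ.map Z) := Measure.isProbabilityMeasure_map hZ'.aemeasurable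
  have : IsProbabilityMeasure (μ.map fun ω => (Y ω, Z ω)) :=
    Measure.isProbabilityMeasure_map (hY'.prodMk hZ').aemeasurable
  set π := μ.map fun ω => (Y ω, Z ω)
  set ρ := (μ.map Y).prod (μ.map Z)
  have approx : ∀ (κ : Measure (E × F)) [IsFiniteMeasure κ] (s t : Set (E × F)),
      κ.real s ≤ κ.real t + κ.real (symmDiff t s) := by
    intro κ _ s t
    refine (measureReal_mono ?_ (measure_ne_top _ _)).trans (measureReal_union_le t _)
    intro x hx
    by_cases hxt : x ∈ t
    · exact Or.inl hxt
    · exact Or.inr (Or.inr ⟨hx, hxt⟩)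
  refine le_of_forall_pos_le_add fun ε hε => ?_
  -- Approximating with respect to `π + ρ` yields a single grid set close to `D` for both laws.
  obtain ⟨t, ht, hlt⟩ := exists_measure_symmDiff_lt_of_generateFrom_isSetRing (μ := π + ρ)
    isSetRing_gridSets ⟨{Set.univ}, Set.countable_singleton _,
      Set.singleton_subset_iff.2 univ_mem_gridSets, by simp⟩ generateFrom_gridSets hD
    (ε := ENNReal.ofReal ε) (by simpa using hε)
  have hsum : π.real (symmDiff t D) + ρ.real (symmDiff t D) ≤ ε := by
    rw [← measureReal_add_apply]
    exact ENNReal.toReal_le_of_le_ofReal hε.le hlt.le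
  have h1 := approx π D t
  have h2 := approx ρ t D
  rw [symmDiff_comm] at h2
  have h3 := map_prod_sub_le_betaCoeff_of_gridSets μ h𝒜 hℬ hY hZ ht
  linarith

/-- Layer-cake: each integral is `∫₀ᶜ` of the measure of `{s ≤ f}`, and the error `b` at every level
`s` integrates to `c * b`. -/
theorem integral_le_add_mul_of_measureReal_le {α : Type*} [MeasurableSpace α] {π ρ : Measure α}
    [IsProbabilityMeasure π] [IsProbabilityMeasure ρ] {b : ℝ}
    (h : ∀ D, MeasurableSet D → π.real D ≤ ρ.real D + b) {f : α → ℝ} (hf : Measurable f) {c : ℝ}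
    (hc : 0 ≤ c) (hπ : ∀ᵐ x ∂π, f x ∈ Set.Icc 0 c) (hρ : ∀ᵐ x ∂ρ, f x ∈ Set.Icc 0 c) :
    ∫ x, f x ∂π ≤ ∫ x, f x ∂ρ + c * b := by
  have hint : ∀ (κ : Measure α) [IsProbabilityMeasure κ], (∀ᵐ x ∂κ, f x ∈ Set.Icc 0 c) →
      Integrable f κ := fun κ _ hκ => by
    refine Integrable.of_bound hf.aestronglyMeasurable c ?_
    filter_upwards [hκ] with x hx
    rw [Real.norm_of_nonneg hx.1]
    exact hx.2
  have hfin : ∀ (κ : Measure α) [IsProbabilityMeasure κ],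
      IntegrableOn (fun s => κ.real {a | s ≤ f a}) (Set.Ioc 0 c) := fun κ _ => by
    -- Monotonicity of the tail function in `s` gives its integrability on `(0, c]`.
    have : Antitone fun s => κ.real {a | s ≤ f a} := fun s s' hs =>
      measureReal_mono fun a (ha : s' ≤ f a) => hs.trans ha
    exact (intervalIntegrable_iff_integrableOn_Ioc_of_le hc).1 this.intervalIntegrable
  rw [(hint π hπ).integral_eq_integral_Ioc_meas_le (hπ.mono fun x hx => hx.1)
      (hπ.mono fun x hx => hx.2),
    (hint ρ hρ).integral_eq_integral_Ioc_meas_le (hρ.mono fun x hx => hx.1)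
      (hρ.mono fun x hx => hx.2)]
  have hcb : c * b = ∫ _ in Set.Ioc 0 c, b := by
    simp [hc]
  rw [hcb, ← integral_add (hfin ρ) (integrable_const b)]
  exact integral_mono (hfin π) ((hfin ρ).add (integrable_const b))
    fun s => h _ (measurableSet_le measurable_const hf)

end AbsoluteRegularity

/-! ### Trace exponentials of sums of independent random matrices -/

section RandomMatrices

variable {𝕜 : Type*} [RCLike 𝕜] {d : ℕ}

theorem integrable_trExp_comp {Ω : Type*} [MeasurableSpace Ω] {μ : Measure Ω}
    [IsFiniteMeasure μ] {Y : Ω → Matrix (Fin d) (Fin d) 𝕜} (hY : AEMeasurable Y μ) {C : ℝ}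
    (hYC : ∀ᵐ ω ∂μ, Y ω ∈ loewnerLe 𝕜 d C) : Integrable (fun ω => trExp (Y ω)) μ := by
  refine Integrable.of_bound (measurable_trExp.comp_aemeasurable hY).aestronglyMeasurable
    (Real.exp C * d) ?_
  filter_upwards [hYC] with ω hω
  rw [Real.norm_of_nonneg (trExp_nonneg (isHermitian_of_mem_loewnerLe hω))]
  exact trExp_le_of_mem_loewnerLe hω

theorem integrable_conj_entry {ρ : Measure (Matrix (Fin d) (Fin d) 𝕜)}
    (hint : ∀ i j, Integrable (fun b : Matrix (Fin d) (Fin d) 𝕜 => b i j) ρ)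
    (U : Matrix (Fin d) (Fin d) 𝕜) (j : Fin d) :
    Integrable (fun b : Matrix (Fin d) (Fin d) 𝕜 => (star U * b * U) j j) ρ := by
  simp only [Matrix.mul_apply]
  exact integrable_finsetSum _ fun k _ =>
    (integrable_finsetSum _ fun l _ => (hint l k).const_mul _).mul_const _

theorem integral_conj_entry {ρ : Measure (Matrix (Fin d) (Fin d) 𝕜)}
    (hint : ∀ i j, Integrable (fun b : Matrix (Fin d) (Fin d) 𝕜 => b i j) ρ)
    (hmean : ∀ i j, ∫ b, b i j ∂ρ = 0) (U : Matrix (Fin d) (Fin d) 𝕜) (j : Fin d) :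
    ∫ b, (star U * b * U) j j ∂ρ = 0 := by
  simp only [Matrix.mul_apply]
  rw [integral_finsetSum _ fun k _ =>
    (integrable_finsetSum _ fun l _ => (hint l k).const_mul _).mul_const _]
  refine Finset.sum_eq_zero fun k _ => ?_
  rw [integral_mul_const, integral_finsetSum _ fun l _ => (hint l k).const_mul _]
  simp [integral_const_mul, hmean]

/-- Averaging over a centred perturbation does not decrease the trace exponential. -/
theorem trExp_le_integral_trExp_add {ρ : Measure (Matrix (Fin d) (Fin d) 𝕜)}
    [IsProbabilityMeasure ρ] {C : ℝ} (hρ : ∀ᵐ b ∂ρ, b ∈ loewnerLe 𝕜 d C)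
    (hint : ∀ i j, Integrable (fun b : Matrix (Fin d) (Fin d) 𝕜 => b i j) ρ)
    (hmean : ∀ i j, ∫ b, b i j ∂ρ = 0) {C' : ℝ} {a : Matrix (Fin d) (Fin d) 𝕜}
    (ha : a ∈ loewnerLe 𝕜 d C') : trExp a ≤ ∫ b, trExp (a + b) ∂ρ := by
  have haH := isHermitian_of_mem_loewnerLe ha
  obtain ⟨U, hU, hD⟩ := haH.exists_unitary_diagonal
  set l := haH.eigenvalues
  have hI : Integrable (fun b => trExp (a + b)) ρ := by
    refine integrable_trExp_comp (C := C' + C) (by fun_prop) ?_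
    filter_upwards [hρ] with b hb using add_mem_loewnerLe ha hb
  have hIr : ∀ j, Integrable (fun b => RCLike.re ((star U * b * U) j j)) ρ :=
    fun j => (integrable_conj_entry hint U j).re
  have hIl : ∀ j, Integrable
      (fun b => Real.exp (l j) * (RCLike.re ((star U * b * U) j j) + 1)) ρ :=
    fun j => ((hIr j).add (integrable_const 1)).const_mul _
  -- In an eigenbasis of `a`, Peierls' inequality and `1 + x ≤ e^x` bound `Tr e^(a+b)` below by this
  -- integrand. It is affine in `b`, so centring leaves only `∑ e^(l j)`.
  have hlow : ∫ b, ∑ j, Real.exp (l j) * (RCLike.re ((star U * b * U) j j) + 1) ∂ρ = trExp a := by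
    rw [integral_finsetSum _ fun j _ => hIl j, ← trExp_unitary_conj hU a, hD, trExp_diagonal]
    refine Finset.sum_congr rfl fun j _ => ?_
    rw [integral_const_mul, integral_add (hIr j) (integrable_const 1),
      integral_re (integrable_conj_entry hint U j), integral_conj_entry hint hmean]
    simp
  rw [← hlow]
  refine integral_mono_ae (integrable_finsetSum _ fun j _ => hIl j) hI ?_
  filter_upwards [hρ] with b hb
  have hs := haH.add (isHermitian_of_mem_loewnerLe hb)
  rw [← trExp_unitary_conj hU (a + b)]
  refine le_trans (Finset.sum_le_sum fun j _ => ?_)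
    (sum_exp_diag_le_trExp (isHermitian_star_mul_mul hs U))
  rw [mul_add (star U), add_mul, hD, Matrix.add_apply, Matrix.diagonal_apply_eq, map_add,
    RCLike.ofReal_re, Real.exp_add]
  exact mul_le_mul_of_nonneg_left (Real.add_one_le_exp _) (Real.exp_pos _).le

theorem ae_conv_mem_loewnerLe {κ P : Measure (Matrix (Fin d) (Fin d) 𝕜)}
    [IsProbabilityMeasure κ] [IsProbabilityMeasure P] {C C' : ℝ}
    (hR : ∀ᵐ b ∂κ, b ∈ loewnerLe 𝕜 d C) (hP : ∀ᵐ b ∂P, b ∈ loewnerLe 𝕜 d C') :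
    ∀ᵐ b ∂(κ ∗ P), b ∈ loewnerLe 𝕜 d (C + C') := by
  refine (ae_map_iff (by fun_prop) (measurableSet_loewnerLe _)).2 ?_
  filter_upwards [Measure.quasiMeasurePreserving_fst.ae hR,
    Measure.quasiMeasurePreserving_snd.ae hP] with x h1 h2 using add_mem_loewnerLe h1 h2

theorem integrable_trExp_conv {κ P : Measure (Matrix (Fin d) (Fin d) 𝕜)}
    [IsProbabilityMeasure κ] [IsProbabilityMeasure P] {C C' : ℝ}
    (hR : ∀ᵐ b ∂κ, b ∈ loewnerLe 𝕜 d C) (hP : ∀ᵐ b ∂P, b ∈ loewnerLe 𝕜 d C') :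
    Integrable trExp (κ ∗ P) :=
  integrable_trExp_comp aemeasurable_id (ae_conv_mem_loewnerLe hR hP)

/-- If `π` is at distance at most `b` in total variation from the centred law `ρ`, then replacing
`π` by `ρ` as the law of an independent summand bounded by `C` costs at most a factor
`1 + b e^C`. -/
theorem integral_trExp_conv_le {π ρ : Measure (Matrix (Fin d) (Fin d) 𝕜)}
    [IsProbabilityMeasure π] [IsProbabilityMeasure ρ] {b C : ℝ} (hb : 0 ≤ b)
    (h : ∀ D, MeasurableSet D → π.real D ≤ ρ.real D + b)
    (hπ : ∀ᵐ x ∂π, x ∈ loewnerLe 𝕜 d C) (hρ : ∀ᵐ x ∂ρ, x ∈ loewnerLe 𝕜 d C)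
    (hint : ∀ i j, Integrable (fun x : Matrix (Fin d) (Fin d) 𝕜 => x i j) ρ)
    (hmean : ∀ i j, ∫ x, x i j ∂ρ = 0) {κ : Measure (Matrix (Fin d) (Fin d) 𝕜)}
    [IsProbabilityMeasure κ] {C' : ℝ} (hR : ∀ᵐ x ∂κ, x ∈ loewnerLe 𝕜 d C') :
    ∫ x, trExp x ∂(κ ∗ π) ≤ (∫ x, trExp x ∂(κ ∗ ρ)) * (1 + b * Real.exp C) := by
  have hT : Integrable (trExp : Matrix (Fin d) (Fin d) 𝕜 → ℝ) κ :=
    integrable_trExp_comp aemeasurable_id hR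
  have hT0 : 0 ≤ ∫ a, trExp a ∂κ := integral_nonneg_of_ae <| by
    filter_upwards [hR] with a ha using trExp_nonneg (isHermitian_of_mem_loewnerLe ha)
  have hf : Measurable fun x : Matrix (Fin d) (Fin d) 𝕜 => ∫ a, trExp (x + a) ∂κ := by
    refine StronglyMeasurable.measurable ?_
    refine StronglyMeasurable.integral_prod_right' (f := fun p : _ × _ => trExp (p.1 + p.2)) ?_
    exact (measurable_trExp.comp (by fun_prop)).stronglyMeasurable
  have hbd : ∀ x ∈ loewnerLe 𝕜 d C,
      (∫ a, trExp (x + a) ∂κ) ∈ Set.Icc 0 (Real.exp C * ∫ a, trExp a ∂κ) := by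
    intro x hx
    refine ⟨integral_nonneg_of_ae ?_, ?_⟩
    · filter_upwards [hR] with a ha using
        trExp_nonneg (isHermitian_of_mem_loewnerLe (add_mem_loewnerLe hx ha))
    · rw [← integral_const_mul]
      refine integral_mono_ae (integrable_trExp_comp (C := C + C') (by fun_prop) ?_)
        (hT.const_mul _) ?_
      · filter_upwards [hR] with a ha using add_mem_loewnerLe hx ha
      · filter_upwards [hR] with a ha
        rw [add_comm x a]
        exact trExp_add_le (isHermitian_of_mem_loewnerLe ha) hx
  have hmain := integral_le_add_mul_of_measureReal_le h hf (mul_nonneg (Real.exp_pos C).le hT0)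
    (hπ.mono hbd) (hρ.mono hbd)
  -- This makes the additive error proportional to the target integral, hence a multiplicative
  -- factor.
  have hjensen : ∫ a, trExp a ∂κ ≤ ∫ x, trExp x ∂(κ ∗ ρ) := by
    have hI := integrable_trExp_conv hR hρ
    rw [integral_conv hI]
    refine integral_mono_ae hT ?_ ?_
    · rw [Measure.conv, integrable_map_measure hI.aestronglyMeasurable (by fun_prop)] at hI
      exact hI.integral_prod_left
    · filter_upwards [hR] with a ha using trExp_le_integral_trExp_add hρ hint hmean ha
  rw [← integral_conv (integrable_trExp_conv hπ hR),
    ← integral_conv (integrable_trExp_conv hρ hR)] at hmain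
  rw [Measure.conv_comm κ π, Measure.conv_comm κ ρ] at *
  calc ∫ x, trExp x ∂(π ∗ κ)
      ≤ ∫ x, trExp x ∂(ρ ∗ κ) + Real.exp C * (∫ a, trExp a ∂κ) * b := hmain
    _ ≤ ∫ x, trExp x ∂(ρ ∗ κ) + Real.exp C * (∫ x, trExp x ∂(ρ ∗ κ)) * b := by gcongr
    _ = _ := by ring

theorem ae_map_sum_mem_loewnerLe {Ω ι : Type*} [MeasurableSpace Ω] {μ : Measure Ω}
    {V : ι → Ω → Matrix (Fin d) (Fin d) 𝕜} (hV : ∀ i, Measurable (V i)) {C : ℝ}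
    (hVC : ∀ i, ∀ᵐ ω ∂μ, V i ω ∈ loewnerLe 𝕜 d C) (s : Finset ι) :
    ∀ᵐ x ∂(μ.map (∑ i ∈ s, V i)), x ∈ loewnerLe 𝕜 d (s.card * C) := by
  have hs : Measurable (∑ i ∈ s, V i) := Finset.sum_fn s V ▸ Finset.measurable_sum s fun i _ => hV i
  refine (ae_map_iff hs.aemeasurable (measurableSet_loewnerLe _)).2 ?_
  filter_upwards [(Finset.eventually_all s).2 fun i _ => hVC i] with ω hω
  rw [Finset.sum_apply]
  exact sum_mem_loewnerLe s hω

/-- Replacing one by one the laws of independent summands. -/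
theorem integral_trExp_conv_map_sum_le {Ω₁ Ω₂ ι : Type*} [MeasurableSpace Ω₁]
    [MeasurableSpace Ω₂] {μ₁ : Measure Ω₁} [IsProbabilityMeasure μ₁] {μ₂ : Measure Ω₂}
    [IsProbabilityMeasure μ₂] {V : ι → Ω₁ → Matrix (Fin d) (Fin d) 𝕜}
    {W : ι → Ω₂ → Matrix (Fin d) (Fin d) 𝕜} (hV : ∀ i, Measurable (V i))
    (hW : ∀ i, Measurable (W i)) {C : ℝ}
    (hVC : ∀ i, ∀ᵐ ω ∂μ₁, V i ω ∈ loewnerLe 𝕜 d C)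
    (hWC : ∀ i, ∀ᵐ ω ∂μ₂, W i ω ∈ loewnerLe 𝕜 d C)
    (hVind : ∀ (s : Finset ι) (i), i ∉ s → IndepFun (∑ j ∈ s, V j) (V i) μ₁)
    (hWind : ∀ (s : Finset ι) (i), i ∉ s → IndepFun (∑ j ∈ s, W j) (W i) μ₂) {q : ℝ}
    (hq : 0 ≤ q)
    (hstep : ∀ (i : ι) (κ : Measure (Matrix (Fin d) (Fin d) 𝕜)) (C' : ℝ),
      IsProbabilityMeasure κ → (∀ᵐ x ∂κ, x ∈ loewnerLe 𝕜 d C') →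
      ∫ x, trExp x ∂(κ ∗ μ₁.map (V i)) ≤ (∫ x, trExp x ∂(κ ∗ μ₂.map (W i))) * q)
    (s : Finset ι) (κ : Measure (Matrix (Fin d) (Fin d) 𝕜)) (C' : ℝ) [IsProbabilityMeasure κ]
    (hR : ∀ᵐ x ∂κ, x ∈ loewnerLe 𝕜 d C') :
    ∫ x, trExp x ∂(κ ∗ μ₁.map (∑ i ∈ s, V i)) ≤
      (∫ x, trExp x ∂(κ ∗ μ₂.map (∑ i ∈ s, W i))) * q ^ s.card := by
  classical
  induction s using Finset.induction_on generalizing κ C' with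
  | empty =>
    have e₁ : μ₁.map (0 : Ω₁ → Matrix (Fin d) (Fin d) 𝕜) = Measure.dirac 0 :=
      (Measure.map_const μ₁ 0).trans (by simp)
    have e₂ : μ₂.map (0 : Ω₂ → Matrix (Fin d) (Fin d) 𝕜) = Measure.dirac 0 :=
      (Measure.map_const μ₂ 0).trans (by simp)
    simp [e₁, e₂]
  | insert i s hi ih =>
    have hVs : Measurable (∑ j ∈ s, V j) := Finset.sum_fn s V ▸ Finset.measurable_sum s fun i _ => hV i
    have hWs : Measurable (∑ j ∈ s, W j) := Finset.sum_fn s W ▸ Finset.measurable_sum s fun i _ => hW i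
    have p1 := Measure.isProbabilityMeasure_map (μ := μ₁) (hV i).aemeasurable
    have p2 := Measure.isProbabilityMeasure_map (μ := μ₂) (hW i).aemeasurable
    have p3 := Measure.isProbabilityMeasure_map (μ := μ₁) hVs.aemeasurable
    have p4 := Measure.isProbabilityMeasure_map (μ := μ₂) hWs.aemeasurable
    have hVi : ∀ᵐ x ∂(μ₁.map (V i)), x ∈ loewnerLe 𝕜 d C :=
      (ae_map_iff (hV i).aemeasurable (measurableSet_loewnerLe _)).2 (hVC i)
    rw [Finset.sum_insert hi, Finset.sum_insert hi, add_comm (V i), add_comm (W i),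
      (hVind s i hi).map_add_eq_map_conv_map hVs (hV i),
      (hWind s i hi).map_add_eq_map_conv_map hWs (hW i), Finset.card_insert_of_notMem hi]
    -- While the summands in `s` are replaced, the law of `V i` is part of the background; it is
    -- then exchanged against a background that contains the new summands. Hence the induction over
    -- arbitrary `κ`.
    have h1 := ih (κ ∗ μ₁.map (V i)) (C' + C) (ae_conv_mem_loewnerLe hR hVi)
    have h2 := hstep i (κ ∗ μ₂.map (∑ j ∈ s, W j)) (C' + s.card * C) inferInstance
      (ae_conv_mem_loewnerLe hR (ae_map_sum_mem_loewnerLe hW hWC s))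
    rw [Measure.conv_assoc, Measure.conv_comm (μ₁.map (V i)), Measure.conv_assoc,
      Measure.conv_comm (μ₁.map (V i)), ← Measure.conv_assoc κ (μ₂.map (∑ j ∈ s, W j))] at h1
    rw [Measure.conv_assoc κ _ (μ₂.map (W i))] at h2
    calc _ ≤ _ := h1
      _ ≤ (∫ x, trExp x ∂(κ ∗ μ₂.map (∑ j ∈ s, W j) ∗ μ₂.map (W i))) * q * q ^ s.card :=
        mul_le_mul_of_nonneg_right h2 (pow_nonneg hq _)
      _ = _ := by ring

end RandomMatrices

/-! ### Geometry of the Cantor-like blocks -/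

section CantorConstruction

variable {A : ℕ}

theorem cantorDelta_pos (hA : 2 ≤ A) : 0 < cantorDelta A := by
  have h : (2 : ℝ) ≤ A := by exact_mod_cast hA
  have h2 := Real.log_pos (one_lt_two (α := ℝ))
  have h3 : 0 < Real.log A := h2.trans_le (Real.log_le_log two_pos h)
  unfold cantorDelta
  positivity

theorem cantorDelta_lt_one (hA : 2 ≤ A) : cantorDelta A < 1 := by
  have h : (2 : ℝ) ≤ A := by exact_mod_cast hA
  have h2 := Real.log_pos (one_lt_two (α := ℝ))
  have h3 := Real.log_le_log two_pos h
  unfold cantorDelta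
  rw [div_lt_one (by linarith)]
  linarith

/-- The inequality defining the depth passes to smaller levels because its left side decreases with
the level. -/
theorem two_le_of_lt_cantorDepth (hA : 2 ≤ A) {j : ℕ} (hj : j < cantorDepth A) :
    2 ≤ (A : ℝ) * cantorDelta A * (1 - cantorDelta A) ^ j / 2 ^ (j + 1) := by
  have hne : {k : ℕ | 1 ≤ k ∧
      2 ≤ (A : ℝ) * cantorDelta A * (1 - cantorDelta A) ^ (k - 1) / 2 ^ k}.Nonempty := by
    by_contra hne
    rw [Set.not_nonempty_iff_eq_empty] at hne
    simp [cantorDepth, hne] at hj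
  have hbdd : BddAbove {k : ℕ | 1 ≤ k ∧
      2 ≤ (A : ℝ) * cantorDelta A * (1 - cantorDelta A) ^ (k - 1) / 2 ^ k} := by
    -- An unbounded set of naturals has `sSup` equal to `0`, which contradicts `j < cantorDepth A`;
    -- boundedness thus needs no separate estimate.
    by_contra hb
    rw [cantorDepth, Nat.sSup_of_not_bddAbove hb] at hj
    omega
  obtain ⟨-, hl⟩ := Nat.sSup_mem hne hbdd
  change 2 ≤ (A : ℝ) * cantorDelta A * (1 - cantorDelta A) ^ (cantorDepth A - 1) /
    2 ^ cantorDepth A at hl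
  refine hl.trans ?_
  have h0 := cantorDelta_pos hA
  have h1 := cantorDelta_lt_one hA
  have hp : (1 - cantorDelta A) ^ (cantorDepth A - 1) ≤ (1 - cantorDelta A) ^ j :=
    pow_le_pow_of_le_one (by linarith) (by linarith) (by omega)
  have h2 : (2 : ℝ) ^ (j + 1) ≤ 2 ^ cantorDepth A := pow_le_pow_right₀ one_le_two hj
  have h3 : 0 ≤ (1 - cantorDelta A) ^ j := pow_nonneg (by linarith) _
  gcongr

theorem one_le_cantorLen (hA : 2 ≤ A) (j : ℕ) : 1 ≤ cantorLen A j := by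
  unfold cantorLen
  split_ifs
  · omega
  · rw [Nat.one_le_ceil_iff]
    have h1 := cantorDelta_lt_one hA
    have : 0 < (1 - cantorDelta A) ^ j := pow_pos (by linarith) _
    have : (0 : ℝ) < A := by exact_mod_cast (by omega : 0 < A)
    positivity

/-- Without ceilings the gap would be `2 * (A δ (1-δ)^j / 2^(j+1)) ≥ 4`, and rounding up the two
children costs at most `2`. So the subtraction in `cantorGap` is exact and the children fit inside
their parent. -/
theorem two_mul_cantorLen_succ_le (hA : 2 ≤ A) {j : ℕ} (hj : j < cantorDepth A) :
    2 * cantorLen A (j + 1) ≤ cantorLen A j := by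
  have hd := two_le_of_lt_cantorDepth hA hj
  have h0 := cantorDelta_pos hA
  have h1 := cantorDelta_lt_one hA
  set δ := cantorDelta A
  have hlow : (A : ℝ) * (1 - δ) ^ j / 2 ^ j ≤ cantorLen A j := by
    unfold cantorLen
    split_ifs with h
    · simp [h]
    · exact Nat.le_ceil _
  have hup : (cantorLen A (j + 1) : ℝ) ≤ (A : ℝ) * (1 - δ) ^ (j + 1) / 2 ^ (j + 1) + 1 := by
    unfold cantorLen
    rw [if_neg (Nat.succ_ne_zero j)]
    refine (Nat.ceil_lt_add_one ?_).le
    have : 0 ≤ (1 - δ) ^ (j + 1) := pow_nonneg (by linarith) _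
    positivity
  have e : (A : ℝ) * (1 - δ) ^ j / 2 ^ j - 2 * ((A : ℝ) * (1 - δ) ^ (j + 1) / 2 ^ (j + 1)) =
      2 * ((A : ℝ) * δ * (1 - δ) ^ j / 2 ^ (j + 1)) := by
    rw [pow_succ, pow_succ]
    field_simp
    ring
  have : (2 * cantorLen A (j + 1) : ℝ) ≤ cantorLen A j := by linarith
  exact_mod_cast this

theorem one_le_cantorLeft (A j i : ℕ) : 1 ≤ cantorLeft A j i := by
  induction j generalizing i with
  | zero => exact le_rfl
  | succ j ih => exact (ih _).trans (Nat.le_add_right _ _)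

theorem cantorInterval_succ_subset (hA : 2 ≤ A) {j : ℕ} (hj : j < cantorDepth A) (i : ℕ) :
    cantorInterval A (j + 1) i ⊆ cantorInterval A j ((i + 1) / 2) := by
  have h := two_mul_cantorLen_succ_le hA hj
  rw [cantorInterval, cantorInterval, cantorLeft, cantorGap]
  refine Finset.Ico_subset_Ico (Nat.le_add_right _ _) ?_
  split_ifs <;> omega

/-- The parent of `i` has index `(i + 1) / 2`, which maps the range of descendants at depth `e + 1`
into the range at depth `e`. -/
theorem cantorInterval_subset_of_mem_Icc (hA : 2 ≤ A) {m : ℕ} (j e : ℕ)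
    (he : m + e ≤ cantorDepth A) {i : ℕ} (hi : i ∈ Finset.Icc ((j - 1) * 2 ^ e + 1) (j * 2 ^ e)) :
    cantorInterval A (m + e) i ⊆ cantorInterval A m j := by
  induction e generalizing i with
  | zero =>
    rw [Finset.mem_Icc] at hi
    have : i = j := by omega
    simp [this]
  | succ e ih =>
    refine (cantorInterval_succ_subset hA (j := m + e) (by omega) i).trans (ih (by omega) ?_)
    rw [Finset.mem_Icc, pow_succ, ← mul_assoc, ← mul_assoc] at hi
    rw [Finset.mem_Icc]
    omega

theorem cantorBlock_subset_cantorInterval (hA : 2 ≤ A) {m : ℕ} (hm : m ≤ cantorDepth A) (j : ℕ) :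
    cantorBlock A m j ⊆ cantorInterval A m j := by
  refine Finset.biUnion_subset.2 fun i hi => ?_
  have := cantorInterval_subset_of_mem_Icc hA (m := m) j (cantorDepth A - m) (by omega) hi
  rwa [Nat.add_sub_cancel' hm] at this

theorem one_le_of_mem_cantorBlock {m j i : ℕ} (hi : i ∈ cantorBlock A m j) : 1 ≤ i := by
  obtain ⟨a, -, ha⟩ := Finset.mem_biUnion.1 hi
  exact (one_le_cantorLeft A _ a).trans (Finset.mem_Ico.1 ha).1

theorem card_cantorBlock_le (A m j : ℕ) :
    (cantorBlock A m j).card ≤ 2 ^ (cantorDepth A - m) * cantorLen A (cantorDepth A) := by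
  refine (Finset.card_biUnion_le_card_mul _ _ (cantorLen A (cantorDepth A)) fun i _ => ?_).trans
    (Nat.mul_le_mul_right _ ?_)
  · simp [cantorInterval]
  · rw [Nat.card_Icc]
    generalize 2 ^ (cantorDepth A - m) = P
    rcases j with _ | j
    · simp
    · simp only [Nat.add_sub_cancel, Nat.add_mul, one_mul]
      omega

theorem cantorBlock_eq_union {k : ℕ} (hk : k < cantorDepth A) {j : ℕ} (hj : 1 ≤ j) :
    cantorBlock A k j = cantorBlock A (k + 1) (2 * j - 1) ∪ cantorBlock A (k + 1) (2 * j) := by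
  obtain ⟨e, he⟩ := Nat.exists_eq_add_of_lt hk
  obtain ⟨j, rfl⟩ := Nat.exists_eq_add_of_le' hj
  unfold cantorBlock
  rw [← Finset.union_biUnion]
  congr 1
  rw [show cantorDepth A - k = e + 1 by omega, show cantorDepth A - (k + 1) = e by omega,
    show j + 1 - 1 = j by omega, show 2 * (j + 1) - 1 - 1 = 2 * j by omega,
    show 2 * (j + 1) - 1 = 2 * j + 1 by omega]
  ext i
  simp only [Finset.mem_union, Finset.mem_Icc, pow_succ, Nat.add_mul, one_mul, mul_add, mul_one]
  rw [← mul_assoc j, mul_assoc 2 j, mul_comm (2 ^ e) 2]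
  omega

/-- The upper bound is the last point of `I_{k+1,2j-1}`. The interval `I_{k+1,2j}` starts `d_k + 1`
further on, which is why the coefficient has index `d_k + 1`. -/
theorem cantorBlock_odd_bounds (hA : 2 ≤ A) {k : ℕ} (hk : k < cantorDepth A) {j i : ℕ}
    (hj : 1 ≤ j) (hi : i ∈ cantorBlock A (k + 1) (2 * j - 1)) :
    i ∈ Set.Icc 1 (cantorLeft A k j + cantorLen A (k + 1) - 1) := by
  refine ⟨one_le_of_mem_cantorBlock hi, ?_⟩
  have h := Finset.mem_Ico.1 (cantorBlock_subset_cantorInterval hA (m := k + 1) hk _ hi)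
  have hodd : ¬ Even (2 * j - 1) := by
    rw [Nat.not_even_iff]
    omega
  rw [cantorLeft, if_neg hodd, show (2 * j - 1 + 1) / 2 = j by omega] at h
  omega

theorem cantorBlock_even_bounds (hA : 2 ≤ A) {k : ℕ} (hk : k < cantorDepth A) {j i : ℕ}
    (hi : i ∈ cantorBlock A (k + 1) (2 * j)) :
    i ∈ Set.Ici (cantorLeft A k j + cantorLen A (k + 1) - 1 + (cantorGap A k + 1)) := by
  have h := Finset.mem_Ico.1 (cantorBlock_subset_cantorInterval hA (m := k + 1) hk _ hi)
  rw [cantorLeft, if_pos (even_two_mul j), show (2 * j + 1) / 2 = j by omega] at h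
  have := one_le_cantorLen hA (k + 1)
  simp only [Set.mem_Ici]
  omega

theorem disjoint_cantorBlock (hA : 2 ≤ A) {k : ℕ} (hk : k < cantorDepth A) {j : ℕ}
    (hj : 1 ≤ j) :
    Disjoint (cantorBlock A (k + 1) (2 * j - 1)) (cantorBlock A (k + 1) (2 * j)) := by
  refine Finset.disjoint_left.2 fun i h1 h2 => ?_
  have h3 := (cantorBlock_odd_bounds hA hk hj h1).2
  have h4 : _ ≤ i := cantorBlock_even_bounds hA hk h2
  omega

end CantorConstruction

/-! ### Splitting one block across its gap -/

section Decoupling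

variable {𝕜 : Type*} [RCLike 𝕜] {d : ℕ}

/-- The entries of the law `ρ` are integrable and centred. -/
def IsCentered (ρ : Measure (Matrix (Fin d) (Fin d) 𝕜)) : Prop :=
  ∀ a b, Integrable (fun x : Matrix (Fin d) (Fin d) 𝕜 => x a b) ρ ∧ ∫ x, x a b ∂ρ = 0

theorem measurable_entry (a b : Fin d) :
    Measurable fun x : Matrix (Fin d) (Fin d) 𝕜 => x a b :=
  (measurable_pi_apply b).comp (measurable_pi_apply a)

theorem isCentered_map {Ω : Type*} [MeasurableSpace Ω] {μ : Measure Ω}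
    {Y : Ω → Matrix (Fin d) (Fin d) 𝕜} (hY : Measurable Y)
    (h : ∀ a b, Integrable (fun ω => Y ω a b) μ ∧ ∫ ω, Y ω a b ∂μ = 0) :
    IsCentered (μ.map Y) := by
  intro a b
  have hm := (measurable_entry (𝕜 := 𝕜) a b).aestronglyMeasurable (μ := μ.map Y)
  exact ⟨(integrable_map_measure hm hY.aemeasurable).2 (h a b).1,
    (integral_map hY.aemeasurable hm).trans (h a b).2⟩

theorem IsCentered.conv {ρ ρ' : Measure (Matrix (Fin d) (Fin d) 𝕜)} [IsProbabilityMeasure ρ]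
    [IsProbabilityMeasure ρ'] (h : IsCentered ρ) (h' : IsCentered ρ') :
    IsCentered (ρ ∗ ρ') := by
  refine isCentered_map (by fun_prop) fun a b => ?_
  have i1 := (h a b).1.comp_fst ρ'
  have i2 := (h' a b).1.comp_snd ρ
  simp only [Matrix.add_apply]
  refine ⟨i1.add i2, ?_⟩
  rw [integral_add i1 i2, integral_fun_fst (fun x : Matrix (Fin d) (Fin d) 𝕜 => x a b),
    integral_fun_snd (fun x : Matrix (Fin d) (Fin d) 𝕜 => x a b), (h a b).2, (h' a b).2]
  simp

theorem isCentered_map_smul_sum {Ω : Type*} [MeasurableSpace Ω] {μ : Measure Ω}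
    {X : ℕ → Ω → Matrix (Fin d) (Fin d) 𝕜} (s : Finset ℕ) (hX : ∀ i ∈ s, Measurable (X i))
    (hint : ∀ i ∈ s, ∀ a b, Integrable (fun ω => X i ω a b) μ)
    (hmean : ∀ i ∈ s, ∀ a b, ∫ ω, X i ω a b ∂μ = 0) (t : ℝ) :
    IsCentered (μ.map fun ω => t • ∑ i ∈ s, X i ω) := by
  refine isCentered_map ((Finset.measurable_fun_sum s hX).const_smul t) fun a b => ?_
  simp only [Matrix.smul_apply, Matrix.sum_apply]
  refine ⟨(integrable_finsetSum s fun i hi => hint i hi a b).smul t, ?_⟩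
  rw [integral_smul, integral_finsetSum s fun i hi => hint i hi a b,
    Finset.sum_eq_zero fun i hi => hmean i hi a b, smul_zero]

theorem ae_map_smul_sum_mem_loewnerLe {Ω : Type*} [MeasurableSpace Ω] {μ : Measure Ω}
    {X : ℕ → Ω → Matrix (Fin d) (Fin d) 𝕜} {M : ℝ} {s : Finset ℕ}
    (hX : ∀ i ∈ s, Measurable (X i)) (hherm : ∀ i ∈ s, ∀ ω, (X i ω).IsHermitian)
    (hmax : ∀ i ∈ s, ∀ᵐ ω ∂μ, lambdaMax (X i ω) ≤ M) {t : ℝ} (ht : 0 ≤ t) :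
    ∀ᵐ x ∂(μ.map fun ω => t • ∑ i ∈ s, X i ω), x ∈ loewnerLe 𝕜 d (t * (s.card * M)) := by
  refine (ae_map_iff ((Finset.measurable_fun_sum s hX).const_smul t).aemeasurable
    (measurableSet_loewnerLe _)).2 ?_
  filter_upwards [(Finset.eventually_all s).2 hmax] with ω hω
  exact smul_mem_loewnerLe ht (sum_mem_loewnerLe s fun i hi =>
    mem_loewnerLe_of_lambdaMax_le (hherm i hi ω) (hω i hi))

/-- Lets the independent copies be forgotten: each block sum enters only through a law computed on
the original space. -/
theorem IsIndepBlocks.map_smul_blockSum {Ω Ω' : Type*} [MeasurableSpace Ω] [MeasurableSpace Ω']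
    {μ : Measure Ω} {X : ℕ → Ω → Matrix (Fin d) (Fin d) 𝕜} {A m : ℕ} {μ' : Measure Ω'}
    {V : (j : Finset.Icc (1 : ℕ) (2 ^ m)) → Ω' → (cantorBlock A m j → Matrix (Fin d) (Fin d) 𝕜)}
    (hV : IsIndepBlocks μ X A m μ' V) (t : ℝ) (j : Finset.Icc (1 : ℕ) (2 ^ m)) :
    μ'.map (fun ω => t • blockSum V j ω) =
      μ.map fun ω => t • ∑ i ∈ cantorBlock A m j, X i ω := by
  have hu : Measurable fun v : cantorBlock A m j → Matrix (Fin d) (Fin d) 𝕜 => t • ∑ i, v i :=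
    (Finset.measurable_fun_sum _ fun i _ => measurable_pi_apply i).const_smul t
  have h := ((hV.identDistrib j).comp hu).map_eq
  refine h.trans ?_
  congr 1
  funext ω
  exact congrArg (t • ·) (Finset.sum_coe_sort (cantorBlock A m j) fun i => X i ω)

theorem IsIndepBlocks.measurable_smul_blockSum {Ω Ω' : Type*} [MeasurableSpace Ω]
    [MeasurableSpace Ω'] {μ : Measure Ω} {X : ℕ → Ω → Matrix (Fin d) (Fin d) 𝕜} {A m : ℕ}
    {μ' : Measure Ω'}
    {V : (j : Finset.Icc (1 : ℕ) (2 ^ m)) → Ω' → (cantorBlock A m j → Matrix (Fin d) (Fin d) 𝕜)}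
    (hV : IsIndepBlocks μ X A m μ' V) (t : ℝ) (j : Finset.Icc (1 : ℕ) (2 ^ m)) :
    Measurable fun ω => t • blockSum V j ω :=
  (Finset.measurable_fun_sum _ fun i _ =>
    (measurable_pi_apply i).comp (hV.measurable j)).const_smul t

theorem IsIndepBlocks.iIndepFun_smul_blockSum {Ω Ω' : Type*} [MeasurableSpace Ω]
    [MeasurableSpace Ω'] {μ : Measure Ω} {X : ℕ → Ω → Matrix (Fin d) (Fin d) 𝕜} {A m : ℕ}
    {μ' : Measure Ω'}
    {V : (j : Finset.Icc (1 : ℕ) (2 ^ m)) → Ω' → (cantorBlock A m j → Matrix (Fin d) (Fin d) 𝕜)}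
    (hV : IsIndepBlocks μ X A m μ' V) (t : ℝ) :
    iIndepFun (fun j ω => t • blockSum V j ω) μ' :=
  hV.indep.comp (fun _ v => t • ∑ i, v i) fun _ =>
    (Finset.measurable_fun_sum _ fun i _ => measurable_pi_apply i).const_smul t

/-- Sums of independent variables over pairwise disjoint finite sets are independent. -/
theorem indepFun_sum_sum_of_pairwise_disjoint {Ω ι κ E : Type*} [MeasurableSpace Ω]
    [DecidableEq κ] {μ : Measure Ω} [MeasurableSpace E] [AddCommMonoid E] [MeasurableAdd₂ E]
    {T : κ → Ω → E} (hT : iIndepFun T μ) (hTm : ∀ i, Measurable (T i)) {S : ι → Finset κ}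
    (hS : Pairwise fun i j => Disjoint (S i) (S j)) (s : Finset ι) {i : ι} (hi : i ∉ s) :
    IndepFun (∑ j ∈ s, ∑ a ∈ S j, T a) (∑ a ∈ S i, T a) μ := by
  have hd : Disjoint (s.biUnion S) (S i) := (Finset.disjoint_biUnion_left _ _ _).2 fun j hj =>
    hS fun h => hi (h ▸ hj)
  have h := (hT.indepFun_finset (s.biUnion S) (S i) hd hTm).comp
    (φ := fun v => ∑ a, v a) (ψ := fun v => ∑ a, v a)
    (Finset.measurable_fun_sum _ fun a _ => measurable_pi_apply a)
    (Finset.measurable_fun_sum _ fun a _ => measurable_pi_apply a)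
  rw [← Finset.sum_biUnion fun j _ l _ hjl => hS hjl]
  convert h using 1
  · funext ω
    rw [Finset.sum_apply]
    exact (Finset.sum_coe_sort (s.biUnion S) fun a => T a ω).symm
  · funext ω
    rw [Finset.sum_apply]
    exact (Finset.sum_coe_sort (S i) fun a => T a ω).symm

/-- The left and right children, among the indices of level `k + 1`, of an index of level `k`. -/
def childIndex (k : ℕ) (j : Finset.Icc (1 : ℕ) (2 ^ k)) (e : Fin 2) :
    Finset.Icc (1 : ℕ) (2 ^ (k + 1)) :=
  ⟨2 * j - 1 + e, by
    have := Finset.mem_Icc.1 j.2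
    have := e.2
    rw [Finset.mem_Icc, pow_succ]
    omega⟩

theorem childIndex_injective (k : ℕ) :
    Function.Injective fun p : Finset.Icc (1 : ℕ) (2 ^ k) × Fin 2 => childIndex k p.1 p.2 := by
  rintro ⟨j, e⟩ ⟨j', e'⟩ h
  have h' : 2 * (j : ℕ) - 1 + e = 2 * j' - 1 + e' := congrArg Subtype.val h
  have := Finset.mem_Icc.1 j.2
  have := Finset.mem_Icc.1 j'.2
  have := e.2
  have := e'.2
  ext <;> simp only <;> omega

theorem childIndex_surjective (k : ℕ) :
    Function.Surjective fun p : Finset.Icc (1 : ℕ) (2 ^ k) × Fin 2 => childIndex k p.1 p.2 := by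
  intro i
  have hi := Finset.mem_Icc.1 i.2
  have hp := pow_succ 2 k
  refine ⟨(⟨((i : ℕ) + 1) / 2, Finset.mem_Icc.2 (by omega)⟩, ⟨((i : ℕ) + 1) % 2, by omega⟩), ?_⟩
  apply Subtype.ext
  simp only [childIndex]
  omega

/-- Splitting one block into the two halves separated by the gap. -/
theorem integral_trExp_conv_block_le {Ω : Type*} [MeasurableSpace Ω] (μ : Measure Ω)
    [IsProbabilityMeasure μ] (X : ℕ → Ω → Matrix (Fin d) (Fin d) 𝕜)
    (hX_meas : ∀ i, 1 ≤ i → Measurable (X i))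
    (hX_herm : ∀ i, 1 ≤ i → ∀ ω, (X i ω).IsHermitian) {M : ℝ} (hM : 0 < M)
    (hX_int : ∀ i, 1 ≤ i → ∀ a b, Integrable (fun ω => X i ω a b) μ)
    (hX_mean : ∀ i, 1 ≤ i → ∀ a b, ∫ ω, X i ω a b ∂μ = 0)
    (hX_max : ∀ i, 1 ≤ i → ∀ᵐ ω ∂μ, lambdaMax (X i ω) ≤ M)
    {A : ℕ} (hA : 2 ≤ A) {t : ℝ} (ht : 0 < t) {k : ℕ} (hk : k < cantorDepth A) {j : ℕ}
    (hj : 1 ≤ j) (κ : Measure (Matrix (Fin d) (Fin d) 𝕜)) [IsProbabilityMeasure κ] {C' : ℝ}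
    (hκ : ∀ᵐ x ∂κ, x ∈ loewnerLe 𝕜 d C') :
    ∫ x, trExp x ∂(κ ∗ μ.map fun ω => t • ∑ i ∈ cantorBlock A k j, X i ω) ≤
      (∫ x, trExp x ∂(κ ∗ (μ.map fun ω => t • ∑ i ∈ cantorBlock A (k + 1) (2 * j - 1), X i ω) ∗
        (μ.map fun ω => t • ∑ i ∈ cantorBlock A (k + 1) (2 * j), X i ω))) *
        (1 + betaMix μ X (cantorGap A k + 1) *
          Real.exp (t * M * cantorLen A (cantorDepth A) * 2 ^ (cantorDepth A - k))) := by
  have hone : ∀ {m j i : ℕ}, i ∈ cantorBlock A m j → 1 ≤ i := one_le_of_mem_cantorBlock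
  have hm : ∀ m j, Measurable fun ω => t • ∑ i ∈ cantorBlock A m j, X i ω := fun m j =>
    (Finset.measurable_fun_sum _ fun i hi => hX_meas i (hone hi)).const_smul t
  have hp := fun m j => Measure.isProbabilityMeasure_map (μ := μ) (hm m j).aemeasurable
  have hb := fun m j => ae_map_smul_sum_mem_loewnerLe (μ := μ) (s := cantorBlock A m j)
    (fun i hi => hX_meas i (hone hi)) (fun i hi => hX_herm i (hone hi))
    (fun i hi => hX_max i (hone hi)) ht.le
  have hc := fun m j => isCentered_map_smul_sum (μ := μ) (cantorBlock A m j)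
    (fun i hi => hX_meas i (hone hi)) (fun i hi => hX_int i (hone hi))
    (fun i hi => hX_mean i (hone hi)) t
  have hcard : ∀ m j, ((cantorBlock A m j).card : ℝ) ≤
      2 ^ (cantorDepth A - m) * cantorLen A (cantorDepth A) := fun m j => by
    exact_mod_cast card_cantorBlock_le A m j
  have hcent := (hc (k + 1) (2 * j - 1)).conv (hc (k + 1) (2 * j))
  refine integral_trExp_conv_le (betaMix_nonneg μ X _) ?_ ?_ ?_
    (fun a b => (hcent a b).1) (fun a b => (hcent a b).2) hκ
  · intro D hD
    have hlen := one_le_cantorLen hA (k + 1)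
    have hleft := one_le_cantorLeft A k j
    have hu : 1 ≤ cantorLeft A k j + cantorLen A (k + 1) - 1 := by omega
    have hY : Measurable[sigmaGen X (Set.Icc 1 (cantorLeft A k j + cantorLen A (k + 1) - 1))]
        fun ω => t • ∑ i ∈ cantorBlock A (k + 1) (2 * j - 1), X i ω := by
      refine Measurable.const_smul (Finset.measurable_fun_sum _ fun i hi => ?_) t
      exact measurable_sigmaGen (cantorBlock_odd_bounds hA hk hj hi)
    have hZ : Measurable[sigmaGen X
        (Set.Ici (cantorLeft A k j + cantorLen A (k + 1) - 1 + (cantorGap A k + 1)))]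
        fun ω => t • ∑ i ∈ cantorBlock A (k + 1) (2 * j), X i ω := by
      refine Measurable.const_smul (Finset.measurable_fun_sum _ fun i hi => ?_) t
      exact measurable_sigmaGen (cantorBlock_even_bounds hA hk hi)
    have htv := map_prod_le_add_betaCoeff μ
      (sigmaGen_le fun i hi => hX_meas i hi.1)
      (sigmaGen_le fun i (hi : _ ≤ i) => hX_meas i (by omega)) hY hZ
      (D := (fun x => x.1 + x.2) ⁻¹' D) (measurable_fst.add measurable_snd hD)
    have hmix := betaCoeff_le_betaMix μ hX_meas hu (k := cantorGap A k + 1) (Nat.succ_ne_zero _)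
    have hadd : Measurable fun x : Matrix (Fin d) (Fin d) 𝕜 × Matrix (Fin d) (Fin d) 𝕜 =>
      x.1 + x.2 := measurable_fst.add measurable_snd
    have e : (μ.map fun ω => t • ∑ i ∈ cantorBlock A k j, X i ω) =
        (μ.map fun ω => (t • ∑ i ∈ cantorBlock A (k + 1) (2 * j - 1), X i ω,
          t • ∑ i ∈ cantorBlock A (k + 1) (2 * j), X i ω)).map fun x => x.1 + x.2 := by
      rw [Measure.map_map hadd ((hm _ _).prodMk (hm _ _))]
      congr 1
      funext ω
      rw [cantorBlock_eq_union hk hj, Finset.sum_union (disjoint_cantorBlock hA hk hj), smul_add]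
      rfl
    rw [e, Measure.conv, map_measureReal_apply hadd hD, map_measureReal_apply hadd hD]
    exact htv.trans (add_le_add le_rfl hmix)
  · filter_upwards [hb k j] with x hx
    refine loewnerLe_mono ?_ hx
    calc t * ((cantorBlock A k j).card * M)
        ≤ t * ((2 ^ (cantorDepth A - k) * cantorLen A (cantorDepth A)) * M) := by
          gcongr
          exact hcard k j
      _ = _ := by ring
  · filter_upwards [ae_conv_mem_loewnerLe (hb (k + 1) (2 * j - 1)) (hb (k + 1) (2 * j))]
      with x hx
    refine loewnerLe_mono ?_ hx
    have h1 := hcard (k + 1) (2 * j - 1)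
    have h2 := hcard (k + 1) (2 * j)
    have h3 : (2 : ℝ) ^ (cantorDepth A - k) = 2 * 2 ^ (cantorDepth A - (k + 1)) := by
      rw [← pow_succ']
      congr 1
      omega
    rw [← mul_add, ← add_mul]
    calc t * (((cantorBlock A (k + 1) (2 * j - 1)).card +
          ((cantorBlock A (k + 1) (2 * j)).card : ℝ)) * M)
        ≤ t * ((2 * 2 ^ (cantorDepth A - (k + 1)) * cantorLen A (cantorDepth A)) * M) := by
          gcongr
          linarith
      _ = _ := by rw [h3]; ring

end Decoupling

theorem lemma4p5 {𝕜 : Type*} [RCLike 𝕜] {d : ℕ}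
    {Ω : Type*} [MeasurableSpace Ω] (μ : Measure Ω) [IsProbabilityMeasure μ]
    (X : ℕ → Ω → Matrix (Fin d) (Fin d) 𝕜)
    (hX_meas : ∀ i, 1 ≤ i → Measurable (X i))
    (hX_herm : ∀ i, 1 ≤ i → ∀ ω, (X i ω).IsHermitian)
    (M : ℝ) (hM : 0 < M)
    (hX_int : ∀ i, 1 ≤ i → ∀ a b, Integrable (fun ω => X i ω a b) μ)
    (hX_mean : ∀ i, 1 ≤ i → ∀ a b, ∫ ω, X i ω a b ∂μ = 0)
    (hX_max : ∀ i, 1 ≤ i → ∀ᵐ ω ∂μ, lambdaMax (X i ω) ≤ M)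
    (A : ℕ) (hA : 2 ≤ A) (t : ℝ) (ht : 0 < t)
    (k : ℕ) (hk : k < cantorDepth A)
    {Ω₁ : Type*} [MeasurableSpace Ω₁] (μ₁ : Measure Ω₁) [IsProbabilityMeasure μ₁]
    (V : (j : Finset.Icc (1 : ℕ) (2 ^ k)) → Ω₁ →
      (cantorBlock A k j → Matrix (Fin d) (Fin d) 𝕜))
    (hV : IsIndepBlocks μ X A k μ₁ V)
    {Ω₂ : Type*} [MeasurableSpace Ω₂] (μ₂ : Measure Ω₂) [IsProbabilityMeasure μ₂]
    (W : (j : Finset.Icc (1 : ℕ) (2 ^ (k + 1))) → Ω₂ →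
      (cantorBlock A (k + 1) j → Matrix (Fin d) (Fin d) 𝕜))
    (hW : IsIndepBlocks μ X A (k + 1) μ₂ W) :
    Integrable (fun ω => trExp (t • ∑ j, blockSum V j ω)) μ₁ ∧
    Integrable (fun ω => trExp (t • ∑ j, blockSum W j ω)) μ₂ ∧
    ∫ ω, trExp (t • ∑ j, blockSum V j ω) ∂μ₁ ≤
      (∫ ω, trExp (t • ∑ j, blockSum W j ω) ∂μ₂) *
        (1 + betaMix μ X (cantorGap A k + 1) *
          Real.exp (t * M * cantorLen A (cantorDepth A) * 2 ^ (cantorDepth A - k))) ^ (2 ^ k) := by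
  classical
  have hone : ∀ {m j i : ℕ}, i ∈ cantorBlock A m j → 1 ≤ i := one_le_of_mem_cantorBlock
  set C : ℝ := t * (2 ^ cantorDepth A * cantorLen A (cantorDepth A) * M)
  have hlaw : ∀ m j, ∀ᵐ x ∂(μ.map fun ω => t • ∑ i ∈ cantorBlock A m j, X i ω),
      x ∈ loewnerLe 𝕜 d C := by
    intro m j
    filter_upwards [ae_map_smul_sum_mem_loewnerLe (μ := μ) (s := cantorBlock A m j)
      (fun i hi => hX_meas i (hone hi)) (fun i hi => hX_herm i (hone hi))
      (fun i hi => hX_max i (hone hi)) ht.le] with x hx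
    refine loewnerLe_mono ?_ hx
    have h1 : ((cantorBlock A m j).card : ℝ) ≤
        2 ^ (cantorDepth A - m) * cantorLen A (cantorDepth A) := by
      exact_mod_cast card_cantorBlock_le A m j
    have h2 : (2 : ℝ) ^ (cantorDepth A - m) ≤ 2 ^ cantorDepth A :=
      pow_le_pow_right₀ one_le_two (Nat.sub_le _ _)
    have h3 : ((cantorBlock A m j).card : ℝ) ≤
        2 ^ cantorDepth A * cantorLen A (cantorDepth A) := h1.trans (by gcongr)
    change t * ((cantorBlock A m j).card * M) ≤ t * _
    gcongr
  set T₁ := fun j ω => t • blockSum V j ω with hT₁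
  set T₂ := fun j ω => t • blockSum W j ω with hT₂
  have hm₁ : ∀ j, Measurable (T₁ j) := hV.measurable_smul_blockSum t
  have hm₂ : ∀ j, Measurable (T₂ j) := hW.measurable_smul_blockSum t
  have hi₁ : iIndepFun T₁ μ₁ := hV.iIndepFun_smul_blockSum t
  have hi₂ : iIndepFun T₂ μ₂ := hW.iIndepFun_smul_blockSum t
  have hC₁ : ∀ j, ∀ᵐ ω ∂μ₁, T₁ j ω ∈ loewnerLe 𝕜 d C := fun j => by
    refine ae_of_ae_map (hm₁ j).aemeasurable ?_
    rw [hV.map_smul_blockSum t j]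
    exact hlaw k j
  have hC₂ : ∀ j, ∀ᵐ ω ∂μ₂, T₂ j ω ∈ loewnerLe 𝕜 d C := fun j => by
    refine ae_of_ae_map (hm₂ j).aemeasurable ?_
    rw [hW.map_smul_blockSum t j]
    exact hlaw (k + 1) j
  have e₁ : ∀ ω, t • ∑ j, blockSum V j ω = (∑ j, T₁ j) ω := fun ω => by
    rw [Finset.smul_sum, Finset.sum_apply]
  have e₂ : ∀ ω, t • ∑ j, blockSum W j ω = (∑ j, T₂ j) ω := fun ω => by
    rw [Finset.smul_sum, Finset.sum_apply]
  have hs₁ : Measurable (∑ j, T₁ j) :=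
    Finset.sum_fn _ T₁ ▸ Finset.measurable_fun_sum _ fun j _ => hm₁ j
  have hs₂ : Measurable (∑ j, T₂ j) :=
    Finset.sum_fn _ T₂ ▸ Finset.measurable_fun_sum _ fun j _ => hm₂ j
  simp only [e₁, e₂]
  refine ⟨integrable_trExp_comp hs₁.aemeasurable
      (ae_of_ae_map hs₁.aemeasurable (ae_map_sum_mem_loewnerLe hm₁ hC₁ _)),
    integrable_trExp_comp hs₂.aemeasurable
      (ae_of_ae_map hs₂.aemeasurable (ae_map_sum_mem_loewnerLe hm₂ hC₂ _)), ?_⟩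
  set S : Finset.Icc (1 : ℕ) (2 ^ k) → Finset (Finset.Icc (1 : ℕ) (2 ^ (k + 1))) :=
    fun j => Finset.univ.image (childIndex k j)
  have hSsum : ∀ j, ∑ a ∈ S j, T₂ a = T₂ (childIndex k j 0) + T₂ (childIndex k j 1) := fun j => by
    rw [Finset.sum_image fun a _ b _ hab =>
      congrArg Prod.snd (@childIndex_injective k (j, a) (j, b) hab), Fin.sum_univ_two]
  have hSdisj : Pairwise fun i j => Disjoint (S i) (S j) := fun i j hij => by
    refine Finset.disjoint_left.2 fun a ha hb => hij ?_
    obtain ⟨e, -, rfl⟩ := Finset.mem_image.1 ha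
    obtain ⟨e', -, h⟩ := Finset.mem_image.1 hb
    exact (congrArg Prod.fst (@childIndex_injective k (j, e') (i, e) h)).symm
  have hSuniv : Finset.univ.biUnion S = Finset.univ := by
    refine Finset.eq_univ_of_forall fun i => ?_
    obtain ⟨⟨j, e⟩, rfl⟩ := childIndex_surjective k i
    exact Finset.mem_biUnion.2 ⟨j, Finset.mem_univ _, Finset.mem_image_of_mem _ (Finset.mem_univ e)⟩
  have hSm : ∀ j, Measurable (∑ a ∈ S j, T₂ a) := fun j => by
    rw [hSsum]
    exact (hm₂ _).add (hm₂ _)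
  have hSC : ∀ j, ∀ᵐ ω ∂μ₂, (∑ a ∈ S j, T₂ a) ω ∈ loewnerLe 𝕜 d (C + C) := fun j => by
    rw [hSsum]
    filter_upwards [hC₂ (childIndex k j 0), hC₂ (childIndex k j 1)] with ω h1 h2
      using add_mem_loewnerLe h1 h2
  have hC0 : 0 ≤ C := by positivity
  have hq : 0 ≤ 1 + betaMix μ X (cantorGap A k + 1) *
      Real.exp (t * M * cantorLen A (cantorDepth A) * 2 ^ (cantorDepth A - k)) := by
    have := betaMix_nonneg μ X (cantorGap A k + 1)
    positivity
  have hmain := integral_trExp_conv_map_sum_le (C := C + C) hm₁ hSm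
    (fun j => (hC₁ j).mono fun ω h => loewnerLe_mono (by linarith) h) hSC
    (fun s i hi => hi₁.indepFun_finsetSum_of_notMem hm₁ hi)
    (fun s i hi => indepFun_sum_sum_of_pairwise_disjoint hi₂ hm₂ hSdisj s hi) hq
    (fun j κ C' _ hκ => ?_) Finset.univ (Measure.dirac 0) 0
    ((ae_dirac_iff (measurableSet_loewnerLe _)).2 zero_mem_loewnerLe)
  · have p₁ := Measure.isProbabilityMeasure_map (μ := μ₁) hs₁.aemeasurable
    have p₂ := Measure.isProbabilityMeasure_map (μ := μ₂) hs₂.aemeasurable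
    rw [← Finset.sum_biUnion fun j _ l _ hjl => hSdisj hjl, hSuniv, Measure.dirac_zero_conv,
      Measure.dirac_zero_conv,
      integral_map hs₁.aemeasurable measurable_trExp.aestronglyMeasurable,
      integral_map hs₂.aemeasurable measurable_trExp.aestronglyMeasurable] at hmain
    simpa using hmain
  · have hj := Finset.mem_Icc.1 j.2
    rw [hSsum, (hi₂.indepFun fun h => zero_ne_one (congrArg Prod.snd
        (@childIndex_injective k (j, 0) (j, 1) h))).map_add_eq_map_conv_map (hm₂ _) (hm₂ _),
      hV.map_smul_blockSum t j, hW.map_smul_blockSum t, hW.map_smul_blockSum t]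
    have e0 : (childIndex k j 0 : ℕ) = 2 * j - 1 := rfl
    have e1 : (childIndex k j 1 : ℕ) = 2 * j := by
      change 2 * (j : ℕ) - 1 + 1 = 2 * j
      omega
    rw [e0, e1]
    exact integral_trExp_conv_block_le μ X hX_meas hX_herm hM hX_int hX_mean hX_max hA ht hk
      hj.1 κ hκ
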